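/- Let $\Lambda$ be a single vertex $k$-graph, i.e. a monoid with a degree map $d:\Lambda\to\mathbb N^k$, $d(uv)=d(u)+d(v)$, such that whenever $d(w)=p+q$ there are unique $u,v\in\Lambda$ with $w=uv$, $d(u)=p$, $d(v)=q$; put $\Lambda^p=d^{-1}(p)$ and assume that $m_i=|\Lambda^{\varepsilon_i}|$ is finite and non-zero for each standard generator $\varepsilon_i$ of $\mathbb Z^k$, $1\le i\le k$. A Cuntz-type representation of $\Lambda$ in a unital C*-algebra is a monoid homomorphism $w\mapsto S_w$ into its multiplicative monoid with $S_e^*S_f=\delta_{e,f}1$ for $e,f\in\Lambda^{\varepsilon_i}$ and $\sum_{e\in\Lambda^{\varepsilon_i}}S_eS_e^*=1$ for each $i$. Let $\mathcal O_\theta$ be the universal C*-algebra for Cuntz-type representations of $\Lambda$, with universal representation $w\mapsto s_w$. Let $\gamma$ be the gauge action of $\mathbb T^k$, $\gamma_{\mathbf t}(s_w)=\mathbf t^{d(w)}s_w$, and let $\Phi_n(A)=\int_{\mathbb T^k}\mathbf t^{-n}\gamma_{\mathbf t}(A)\,d\mathbf t$ for $n\in\mathbb Z^k$; an element $X$ has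 degree $n$, written $d(X)=n$, if $X\in\operatorname{Ran}\Phi_n$. Let $\mathfrak F=\mathcal O_\theta^\gamma=\operatorname{Ran}\Phi_0$ be the core, $\tau$ its unique tracial state, and $\omega=\tau\circ\Phi_0$. Let $\Delta=S^*S$ be the modular operator of $\omega$ on its GNS space, where $S$ is the closure of $\pi_\omega(A)\Omega\mapsto\pi_\omega(A^*)\Omega$ $(A\in\mathcal O_\theta)$ and $\Omega$ is the canonical cyclic vector; let $\sigma_t=\operatorname{Ad}\Delta^{it}$ and $$\mathcal O_\theta^\sigma=\{A\in\mathcal O_\theta:\ \sigma_t(\pi_\omega(A))=\pi_\omega(A)\text{ for all }t\in\mathbb R\}.$$ Let $G=\{g\in\mathbb Z^k:\ \prod_i m_i^{g_i}=1\}$ be the intrinsic group, let $g_1,\dots,g_r$ be a $\mathbb Z$-basis of $G$, and for $g\in\mathbb Z^k$ let $g_+=g\vee 0$, $g_-=(-g)\vee0$. Then for each $1\le p\le r$ there is a bijection from $\Lambda^{(g_p)_+}$ onto $\Lambda^{(g_p)_-}$, and for every choice of such bijections $\jmath_1,\dots,\jmath_r$ the elements $$U_p=\sum_{u\in\Lambda^{(g_p)_+}}s_u\,s_{\jmath_p(u)}^*\qquad(1\le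 p\le r)$$ are unitary and $$\mathcal O_\theta^\sigma=\mathrm C^*(X\in\mathcal O_\theta:\ d(X)\in G)=\mathrm C^*(\mathfrak F,U_1,\dots,U_r)$$ (for $r=0$ the last algebra is $\mathfrak F$). -/

import Mathlib

open scoped ENNReal InnerProductSpace ComplexOrder
open UnitAddTorus MeasureTheory

noncomputable section

/-- A single vertex `k`-graph: a small category with one object, that is a monoid `Λ`, together
with a degree map to `ℕᵏ` having the factorization property; for each of the `k` colours there are
finitely many, and at least one, edges of that colour. -/
structure SingleVertexKGraph (k : ℕ) (Λ : Type*) [Monoid Λ] where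
  /-- the degree map -/
  deg : Λ → Fin k → ℕ
  deg_one : deg 1 = 0
  deg_mul : ∀ u v, deg (u * v) = deg u + deg v
  factorization : ∀ (w : Λ) (p q : Fin k → ℕ), deg w = p + q →
    ∃! x : Λ × Λ, w = x.1 * x.2 ∧ deg x.1 = p ∧ deg x.2 = q
  finite_edges : ∀ i, {e | deg e = Pi.single i 1}.Finite
  nonempty_edges : ∀ i, {e | deg e = Pi.single i 1}.Nonempty

lemma StarAlgHom.continuous_of_cstar {A B : Type*} [CStarAlgebra A] [CStarAlgebra B]
    (φ : A →⋆ₐ[ℂ] B) : Continuous φ :=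
  AddMonoidHomClass.continuous_of_bound φ 1 fun a => by
    simpa using NonUnitalStarAlgHom.norm_apply_le φ a

namespace SingleVertexKGraph

variable {k : ℕ} {Λ : Type*} [Monoid Λ] (X : SingleVertexKGraph k Λ)

/-- `Λ^p`, the words of degree `p`. -/
def Words (p : Fin k → ℕ) : Type _ := {w : Λ // X.deg w = p}

instance finite_words (p : Fin k → ℕ) : Finite (X.Words p) := by
  have key : ∀ (N : ℕ) (p : Fin k → ℕ), ∑ i, p i = N → Finite (X.Words p) := by
    intro N
    induction N with
    | zero =>
      intro p hp
      have hp0 : p = 0 := by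
        funext i
        have := (Finset.sum_eq_zero_iff.mp hp) i (Finset.mem_univ i)
        simpa using this
      subst hp0
      have : Subsingleton (X.Words 0) := by
        refine ⟨fun a b => ?_⟩
        have h1 : ∀ w : Λ, X.deg w = 0 → w = 1 := by
          intro w hw
          obtain ⟨x, -, hx⟩ := X.factorization w 0 0 (by simpa using hw)
          have e1 := hx (w, 1) ⟨by simp, hw, X.deg_one⟩
          have e2 := hx (1, w) ⟨by simp, X.deg_one, hw⟩
          exact congrArg Prod.fst (e1.trans e2.symm)
        exact Subtype.ext ((h1 _ a.2).trans (h1 _ b.2).symm)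
      infer_instance
    | succ N ih =>
      intro p hp
      obtain ⟨i, hi⟩ : ∃ i, p i ≠ 0 := by
        by_contra h
        push Not at h
        simp [h] at hp
      have hsplit : p = Pi.single i 1 + (p - Pi.single i 1) := by
        funext j
        by_cases hj : j = i
        · subst hj
          simp only [Pi.add_apply, Pi.single_eq_same, Pi.sub_apply]
          omega
        · simp [Pi.single_eq_of_ne hj]
      have hsum : ∑ j, (p - Pi.single i 1 : Fin k → ℕ) j = N := by
        have h2 : ∑ j, p j = ∑ j, (Pi.single i 1 : Fin k → ℕ) j + ∑ j, (p - Pi.single i 1 : Fin k → ℕ) j := by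
          rw [← Finset.sum_add_distrib]
          exact Finset.sum_congr rfl fun j _ => congrFun hsplit j
        rw [Finset.sum_pi_single'] at h2
        simp only [Finset.mem_univ, if_true] at h2
        omega
      have : Finite (X.Words (p - Pi.single i 1)) := ih _ hsum
      have : Finite {e | X.deg e = Pi.single i 1} := X.finite_edges i
      have hex : ∀ w : X.Words p, ∃ x : {e | X.deg e = Pi.single i 1} ×
          X.Words (p - Pi.single i 1), w.1 = x.1.1 * x.2.1 := by
        intro w
        obtain ⟨x, ⟨h1, h2, h3⟩, -⟩ := X.factorization w.1 _ _ (w.2.trans hsplit)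
        exact ⟨(⟨x.1, h2⟩, ⟨x.2, h3⟩), h1⟩
      choose f hf using hex
      refine Finite.of_injective f fun a b hab => Subtype.ext ?_
      rw [hf a, hf b, hab]
  exact key _ p rfl

instance (p : Fin k → ℕ) : Fintype (X.Words p) := Fintype.ofFinite _

/-- `m_i`, the number of edges of the `i`-th colour. -/
def numEdges (i : Fin k) : ℕ := Fintype.card (X.Words (Pi.single i 1))

lemma numEdges_ne_zero (i : Fin k) : X.numEdges i ≠ 0 := by
  obtain ⟨e, he⟩ := X.nonempty_edges i
  have : Nonempty (X.Words (Pi.single i 1)) := ⟨⟨e, he⟩⟩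
  exact Fintype.card_ne_zero

/-- The intrinsic group `G = {g ∈ ℤᵏ : ∏ i, m_i ^ g_i = 1}`. -/
def intrinsicGroup : AddSubgroup (Fin k → ℤ) where
  carrier := {g | ∏ i, (X.numEdges i : ℚ) ^ g i = 1}
  zero_mem' := by simp
  add_mem' := by
    intro a b ha hb
    have h : ∀ i, (X.numEdges i : ℚ) ≠ 0 := fun i => by exact_mod_cast X.numEdges_ne_zero i
    simp only [Set.mem_ofPred_eq, Pi.add_apply, zpow_add₀ (h _), Finset.prod_mul_distrib] at *
    rw [ha, hb, one_mul]
  neg_mem' := by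
    intro a ha
    simp only [Set.mem_ofPred_eq, Pi.neg_apply, zpow_neg, Finset.prod_inv_distrib] at *
    rw [ha, inv_one]

/-! ### Cuntz-type representations and the `k`-graph C⋆-algebra -/

/-- `S` is a Cuntz-type representation of the `k`-graph in the unital C⋆-algebra `B`: the images of
the edges of each colour are isometries with mutually orthogonal ranges whose range projections sum
to `1` (the commutation relations hold because `S` is multiplicative on `Λ`). -/
structure IsCuntzType {B : Type*} [CStarAlgebra B] (S : Λ →* B) : Prop where
  orthogonal : ∀ (i : Fin k) (e f : X.Words (Pi.single i 1)), e ≠ f → star (S e.1) * S f.1 = 0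
  isometry : ∀ (i : Fin k) (e : X.Words (Pi.single i 1)), star (S e.1) * S e.1 = 1
  sum_eq_one : ∀ i : Fin k, ∑ e : X.Words (Pi.single i 1), S e.1 * star (S e.1) = 1

/-- A Cuntz-type representation in some nonzero C⋆-algebra. -/
structure CuntzRep where
  /-- the C⋆-algebra represented in -/
  B : Type
  [cstar : CStarAlgebra B]
  [nontriv : Nontrivial B]
  /-- the representation -/
  S : Λ →* B
  isCuntz : X.IsCuntzType S

attribute [instance] CuntzRep.cstar CuntzRep.nontriv

/-- The C⋆-algebra of bounded families indexed by all Cuntz-type representations. -/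
def ProdAlg : Type _ := lp (fun r : X.CuntzRep => r.B) ∞

/-- The C⋆-algebra structure (pointwise operations, supremum norm). -/
def prodCStar : CStarAlgebra X.ProdAlg :=
  { lp.inftyNormedRing (B := fun r : X.CuntzRep => r.B),
    lp.inftyStarRing (B := fun r : X.CuntzRep => r.B),
    lp.inftyNormedAlgebra (𝕜 := ℂ) (B := fun r : X.CuntzRep => r.B) with
    norm_mul_self_le := (lp.inftyCStarRing (B := fun r : X.CuntzRep => r.B)).norm_mul_self_le
    complete := (inferInstance : CompleteSpace (lp (fun r : X.CuntzRep => r.B) ∞)).complete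
    star_smul := fun c (a : lp (fun r : X.CuntzRep => r.B) ∞) => star_smul c a }

instance : CStarAlgebra X.ProdAlg := X.prodCStar

/-- The component of a bounded family at a representation. -/
def eval (r : X.CuntzRep) : X.ProdAlg →⋆ₐ[ℂ] r.B where
  toFun a := a.1 r
  map_one' := rfl
  map_mul' _ _ := rfl
  map_zero' := rfl
  map_add' _ _ := rfl
  commutes' _ := rfl
  map_star' _ := rfl

variable {X} in
lemma ProdAlg.ext {a b : X.ProdAlg} (h : ∀ r, X.eval r a = X.eval r b) : a = b :=
  lp.ext (funext h)

/-- Every nontrivial word has a first edge. -/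
lemma exists_edge_mul (w : Λ) (hw : w ≠ 1) :
    ∃ (i : Fin k) (e : X.Words (Pi.single i 1)) (v : Λ), w = e.1 * v ∧
      ∑ j, X.deg w j = ∑ j, X.deg v j + 1 := by
  have h0 : X.deg w ≠ 0 := by
    intro h
    obtain ⟨x, -, hx⟩ := X.factorization w 0 0 (by simpa using h)
    have e1 := hx (w, 1) ⟨by simp, h, X.deg_one⟩
    have e2 := hx (1, w) ⟨by simp, X.deg_one, h⟩
    exact hw (congrArg Prod.fst (e1.trans e2.symm))
  obtain ⟨i, hi⟩ := Function.ne_iff.mp h0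
  have hsplit : X.deg w = Pi.single i 1 + (X.deg w - Pi.single i 1) := by
    funext j
    by_cases hj : j = i
    · subst hj
      simp only [Pi.add_apply, Pi.single_eq_same, Pi.sub_apply]
      simp only [Pi.zero_apply] at hi
      omega
    · simp [Pi.single_eq_of_ne hj]
  obtain ⟨x, ⟨h1, h2, -⟩, -⟩ := X.factorization w _ _ hsplit
  refine ⟨i, ⟨x.1, h2⟩, x.2, h1, ?_⟩
  rw [h1, X.deg_mul, h2]
  simp only [Pi.add_apply, Finset.sum_add_distrib, Finset.sum_pi_single', Finset.mem_univ, if_true]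
  omega

lemma IsCuntzType.star_mul_self {X : SingleVertexKGraph k Λ} {B : Type*} [CStarAlgebra B]
    {S : Λ →* B} (h : X.IsCuntzType S) (w : Λ) : star (S w) * S w = 1 := by
  induction hN : ∑ j, X.deg w j generalizing w with
  | zero =>
    by_cases hw : w = 1
    · simp [hw]
    · obtain ⟨i, e, v, -, h2⟩ := X.exists_edge_mul w hw
      omega
  | succ N ih =>
    by_cases hw : w = 1
    · simp [hw]
    · obtain ⟨i, e, v, h1, h2⟩ := X.exists_edge_mul w hw
      rw [h1, map_mul, star_mul, mul_assoc, ← mul_assoc (star (S e.1)), h.isometry, one_mul]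
      exact ih v (by omega)

lemma CuntzRep.norm_S (r : X.CuntzRep) (w : Λ) : ‖r.S w‖ = 1 := by
  have h := CStarRing.norm_star_mul_self (x := r.S w)
  rw [r.isCuntz.star_mul_self w, norm_one] at h
  nlinarith [norm_nonneg (r.S w)]

/-- The family of all `r.S w`. -/
def genProd (w : Λ) : X.ProdAlg :=
  ⟨fun r => r.S w, memℓp_infty ⟨1, by rintro _ ⟨r, rfl⟩; exact (r.norm_S X w).le⟩⟩

@[simp] lemma eval_genProd (r : X.CuntzRep) (w : Λ) : X.eval r (X.genProd w) = r.S w := rfl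

/-- The closed ⋆-subalgebra generated by the families `genProd w`. -/
def univSub : StarSubalgebra ℂ X.ProdAlg :=
  (StarAlgebra.adjoin ℂ (Set.range X.genProd)).topologicalClosure

instance : IsClosed (X.univSub : Set X.ProdAlg) := StarSubalgebra.isClosed_topologicalClosure _

/-- The `k`-graph C⋆-algebra `𝒪_θ`: the universal C⋆-algebra for Cuntz-type representations,
realised as the C⋆-algebra generated by the tuple of all such representations. (Each such
representation generates a separable C⋆-algebra, so C⋆-algebras in `Type` suffice.) Its universal
property is `GraphAlg.existsUnique_lift` below. -/
def GraphAlg : Type _ := X.univSub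

/-- The C⋆-algebra structure inherited from the product. -/
def graphCStar : CStarAlgebra X.GraphAlg := StarSubalgebra.cstarAlgebra X.univSub

instance : CStarAlgebra X.GraphAlg := X.graphCStar
instance : PartialOrder X.GraphAlg := CStarAlgebra.spectralOrder _
instance : StarOrderedRing X.GraphAlg := CStarAlgebra.spectralOrderedRing _

/-- The inclusion of `𝒪_θ` in the product. -/
def incl : X.GraphAlg →⋆ₐ[ℂ] X.ProdAlg := X.univSub.subtype

lemma incl_injective : Function.Injective X.incl := Subtype.val_injective

/-- The universal representation `w ↦ s_w` of the `k`-graph in `𝒪_θ`. -/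
def s : Λ →* X.GraphAlg where
  toFun w := ⟨X.genProd w, StarSubalgebra.le_topologicalClosure _
    (StarAlgebra.subset_adjoin ℂ _ ⟨w, rfl⟩)⟩
  map_one' := Subtype.ext (ProdAlg.ext fun r => map_one r.S)
  map_mul' u v := Subtype.ext (ProdAlg.ext fun r => map_mul r.S u v)

@[simp] lemma incl_s (w : Λ) : X.incl (X.s w) = X.genProd w := rfl

lemma incl_star (a : X.GraphAlg) : X.incl (star a) = star (X.incl a) := map_star X.incl a

lemma eval_star (r : X.CuntzRep) (a : X.ProdAlg) : X.eval r (star a) = star (X.eval r a) :=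
  map_star (X.eval r) a

lemma isCuntzType_s : X.IsCuntzType X.s where
  orthogonal i e f h := X.incl_injective <| ProdAlg.ext fun r => by
    simpa [incl_star, eval_star] using r.isCuntz.orthogonal i e f h
  isometry i e := X.incl_injective <| ProdAlg.ext fun r => by
    simpa [incl_star, eval_star] using r.isCuntz.isometry i e
  sum_eq_one i := X.incl_injective <| ProdAlg.ext fun r => by
    simpa [incl_star, eval_star] using r.isCuntz.sum_eq_one i

/-- The ⋆-algebra generated by the `s_w` is dense. -/
lemma dense_adjoin : (StarAlgebra.adjoin ℂ (Set.range X.s)).topologicalClosure = ⊤ := by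
  rw [eq_top_iff]
  rintro a -
  have hmap : (StarAlgebra.adjoin ℂ (Set.range X.s)).map X.incl =
      StarAlgebra.adjoin ℂ (Set.range X.genProd) := by
    rw [StarAlgHom.map_adjoin, ← Set.range_comp]
    rfl
  have ha : X.incl a ∈ closure (X.incl '' (StarAlgebra.adjoin ℂ (Set.range X.s) : Set X.GraphAlg)) := by
    have : X.incl a ∈ X.univSub := a.2
    rw [univSub, ← hmap] at this
    exact this
  have hind : Topology.IsInducing X.incl := Topology.IsInducing.subtypeVal
  change a ∈ closure (StarAlgebra.adjoin ℂ (Set.range X.s) : Set X.GraphAlg)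
  rw [hind.closure_eq_preimage_closure_image]
  exact ha

/-- The universal property of `𝒪_θ`. -/
theorem GraphAlg.existsUnique_lift {B : Type} [CStarAlgebra B] [Nontrivial B] (S : Λ →* B)
    (hS : X.IsCuntzType S) : ∃! φ : X.GraphAlg →⋆ₐ[ℂ] B, ∀ w, φ (X.s w) = S w := by
  refine ⟨(X.eval ⟨B, S, hS⟩).comp X.incl, fun w => rfl, fun φ hφ => ?_⟩
  let ψ : X.GraphAlg →⋆ₐ[ℂ] B := (X.eval ⟨B, S, hS⟩).comp X.incl
  have hcl : IsClosed {a : X.GraphAlg | φ a = ψ a} :=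
    isClosed_eq φ.continuous_of_cstar ψ.continuous_of_cstar
  have hle : StarAlgebra.adjoin ℂ (Set.range X.s) ≤ StarAlgHom.equalizer φ ψ := by
    refine StarAlgebra.adjoin_le ?_
    rintro _ ⟨w, rfl⟩
    exact hφ w
  have htop := StarSubalgebra.topologicalClosure_minimal hle hcl
  rw [X.dense_adjoin] at htop
  exact StarAlgHom.ext fun a => htop (StarSubalgebra.mem_top (x := a))

/-! ### The gauge action, degrees and the core

The torus `𝕋ᵏ` is `UnitAddTorus (Fin k)` with its normalised Haar measure, and `mFourier n t` is
the character `𝐭 ↦ 𝐭ⁿ`. -/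

/-- A word's degree as an element of `ℤᵏ`. -/
def zdeg (w : Λ) : Fin k → ℤ := fun i => (X.deg w i : ℤ)

lemma zdeg_one : X.zdeg 1 = 0 := by
  funext i
  simp [zdeg, X.deg_one]

lemma zdeg_mul (u v : Λ) : X.zdeg (u * v) = X.zdeg u + X.zdeg v := by
  funext i
  simp [zdeg, X.deg_mul]

lemma star_mFourier_mul (n : Fin k → ℤ) (t : UnitAddTorus (Fin k)) :
    star (mFourier n t) * mFourier n t = 1 := by
  rw [Complex.star_def, ← mFourier_neg, ← mFourier_add, neg_add_cancel, mFourier_zero]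
  rfl

lemma mFourier_add_right (n : Fin k → ℤ) (t u : UnitAddTorus (Fin k)) :
    mFourier n (t + u) = mFourier n t * mFourier n u := by
  simp [mFourier, Finset.prod_mul_distrib, fourier_apply, smul_add,
    AddCircle.toCircle_add]

/-- The representation `w ↦ 𝐭^{d(w)} S_w`. -/
def CuntzRep.twist (r : X.CuntzRep) (t : UnitAddTorus (Fin k)) : X.CuntzRep where
  B := r.B
  S :=
    { toFun := fun w => mFourier (X.zdeg w) t • r.S w
      map_one' := by rw [zdeg_one, mFourier_zero, map_one]; simp
      map_mul' := fun u v => by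
        rw [zdeg_mul, mFourier_add, map_mul, smul_mul_smul_comm] }
  isCuntz :=
    { orthogonal := fun i e f h => by
        simp only [MonoidHom.coe_mk, OneHom.coe_mk, star_smul, smul_mul_smul_comm]
        rw [r.isCuntz.orthogonal i e f h, smul_zero]
      isometry := fun i e => by
        simp only [MonoidHom.coe_mk, OneHom.coe_mk, star_smul, smul_mul_smul_comm]
        rw [r.isCuntz.isometry i e, star_mFourier_mul, one_smul]
      sum_eq_one := fun i => by
        simp only [MonoidHom.coe_mk, OneHom.coe_mk, star_smul, smul_mul_smul_comm]
        simp only [mul_comm _ (star _), star_mFourier_mul, one_smul]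
        exact r.isCuntz.sum_eq_one i }

/-- The gauge action on the product, by twisting the index. -/
def gaugeProd (t : UnitAddTorus (Fin k)) : X.ProdAlg →⋆ₐ[ℂ] X.ProdAlg where
  toFun a := ⟨fun r => X.eval (r.twist X t) a, memℓp_infty ⟨‖a‖, by
    rintro _ ⟨r, rfl⟩
    exact NonUnitalStarAlgHom.norm_apply_le (X.eval (r.twist X t)) a⟩⟩
  map_one' := ProdAlg.ext fun r => map_one (X.eval (r.twist X t))
  map_mul' a b := ProdAlg.ext fun r => map_mul (X.eval (r.twist X t)) a b
  map_zero' := ProdAlg.ext fun r => map_zero (X.eval (r.twist X t))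
  map_add' a b := ProdAlg.ext fun r => map_add (X.eval (r.twist X t)) a b
  commutes' c := ProdAlg.ext fun r => AlgHomClass.commutes (X.eval (r.twist X t)) c
  map_star' a := ProdAlg.ext fun r => map_star (X.eval (r.twist X t)) a

lemma gaugeProd_genProd (t : UnitAddTorus (Fin k)) (w : Λ) :
    X.gaugeProd t (X.genProd w) = mFourier (X.zdeg w) t • X.genProd w :=
  ProdAlg.ext fun _ => rfl

lemma gaugeProd_mem (t : UnitAddTorus (Fin k)) {a : X.ProdAlg} (ha : a ∈ X.univSub) :
    X.gaugeProd t a ∈ X.univSub := by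
  have hcl : IsClosed (X.univSub.comap (X.gaugeProd t) : Set X.ProdAlg) :=
    (StarSubalgebra.isClosed_topologicalClosure _).preimage (X.gaugeProd t).continuous_of_cstar
  have hle : StarAlgebra.adjoin ℂ (Set.range X.genProd) ≤ X.univSub.comap (X.gaugeProd t) := by
    refine StarAlgebra.adjoin_le ?_
    rintro _ ⟨w, rfl⟩
    change X.gaugeProd t (X.genProd w) ∈ X.univSub
    rw [gaugeProd_genProd]
    exact SMulMemClass.smul_mem _ (StarSubalgebra.le_topologicalClosure _
      (StarAlgebra.subset_adjoin ℂ _ ⟨w, rfl⟩))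
  exact StarSubalgebra.topologicalClosure_minimal hle hcl ha

/-- The gauge automorphism `γ_𝐭`, characterised by `γ_𝐭 (s_w) = 𝐭^{d(w)} s_w` (`gauge_s`). -/
def gauge (t : UnitAddTorus (Fin k)) : X.GraphAlg →⋆ₐ[ℂ] X.GraphAlg where
  toFun a := ⟨X.gaugeProd t (X.incl a), X.gaugeProd_mem t a.2⟩
  map_one' := X.incl_injective (map_one ((X.gaugeProd t).comp X.incl))
  map_mul' a b := X.incl_injective (map_mul ((X.gaugeProd t).comp X.incl) a b)
  map_zero' := X.incl_injective (map_zero ((X.gaugeProd t).comp X.incl))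
  map_add' a b := X.incl_injective (map_add ((X.gaugeProd t).comp X.incl) a b)
  commutes' c := X.incl_injective (AlgHomClass.commutes ((X.gaugeProd t).comp X.incl) c)
  map_star' a := X.incl_injective (map_star ((X.gaugeProd t).comp X.incl) a)

lemma gauge_s (t : UnitAddTorus (Fin k)) (w : Λ) :
    X.gauge t (X.s w) = mFourier (X.zdeg w) t • X.s w :=
  X.incl_injective (X.gaugeProd_genProd t w)

lemma GraphAlg.induction {P : X.GraphAlg → Prop} (hP : IsClosed {a | P a})
    (hs : ∀ w, P (X.s w)) (hc : ∀ c, P (algebraMap ℂ _ c)) (ha : ∀ a b, P a → P b → P (a + b))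
    (hm : ∀ a b, P a → P b → P (a * b)) (hst : ∀ a, P a → P (star a)) (a : X.GraphAlg) : P a := by
  let T : StarSubalgebra ℂ X.GraphAlg :=
    { carrier := {a | P a}
      mul_mem' := fun h h' => hm _ _ h h'
      add_mem' := fun h h' => ha _ _ h h'
      algebraMap_mem' := hc
      star_mem' := fun h => hst _ h }
  have hle : StarAlgebra.adjoin ℂ (Set.range X.s) ≤ T := by
    refine StarAlgebra.adjoin_le ?_
    rintro _ ⟨w, rfl⟩
    exact hs w
  have htop := StarSubalgebra.topologicalClosure_minimal hle hP
  rw [X.dense_adjoin] at htop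
  exact htop (StarSubalgebra.mem_top (x := a))

lemma gauge_gauge (t u : UnitAddTorus (Fin k)) (a : X.GraphAlg) :
    X.gauge t (X.gauge u a) = X.gauge (t + u) a := by
  induction a using GraphAlg.induction with
  | hP => exact isClosed_eq ((X.gauge t).continuous_of_cstar.comp (X.gauge u).continuous_of_cstar)
            (X.gauge (t + u)).continuous_of_cstar
  | hs w =>
    rw [gauge_s, map_smul, gauge_s, gauge_s, smul_smul, mFourier_add_right, mul_comm]
  | hc c => simp only [AlgHomClass.commutes]
  | ha a b h1 h2 => simp only [map_add, h1, h2]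
  | hm a b h1 h2 => simp only [map_mul, h1, h2]
  | hst a h => rw [map_star, map_star, map_star, h]

lemma continuous_gauge (a : X.GraphAlg) : Continuous fun t => X.gauge t a := by
  induction a using GraphAlg.induction with
  | hP =>
    refine isClosed_of_closure_subset fun a ha => ?_
    refine Metric.continuous_iff'.mpr fun t ε hε => ?_
    obtain ⟨b, hb, hab⟩ := Metric.mem_closure_iff.mp ha (ε / 3) (by positivity)
    have hb' : Continuous fun t => X.gauge t b := hb
    filter_upwards [Metric.continuous_iff'.mp hb' t (ε / 3) (by positivity)] with u hu
    have h1 : ∀ t, dist (X.gauge t a) (X.gauge t b) < ε / 3 := fun t => by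
      rw [dist_eq_norm, ← map_sub]
      exact (NonUnitalStarAlgHom.norm_apply_le (X.gauge t) _).trans_lt (by rwa [← dist_eq_norm])
    have := dist_triangle4_right (X.gauge u a) (X.gauge t a) (X.gauge u b) (X.gauge t b)
    linarith [h1 u, h1 t]
  | hs w =>
    simp only [gauge_s]
    fun_prop
  | hc c => simpa only [AlgHomClass.commutes] using continuous_const
  | ha a b h1 h2 => simp only [map_add]; exact Continuous.add h1 h2
  | hm a b h1 h2 => simp only [map_mul]; exact Continuous.mul h1 h2
  | hst a h => simpa only [map_star] using h.star

/-- `Φ_n(A) = ∫ 𝐭^{-n} γ_𝐭(A) d𝐭`. -/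
def Phi (n : Fin k → ℤ) (a : X.GraphAlg) : X.GraphAlg := ∫ t, mFourier (-n) t • X.gauge t a

/-- `a` has degree `n`: it lies in the range of `Φ_n`. -/
def HasDegree (a : X.GraphAlg) (n : Fin k → ℤ) : Prop := a ∈ Set.range (X.Phi n)

/-- The core `𝔉`, the fixed point algebra of the gauge action. -/
def core : StarSubalgebra ℂ X.GraphAlg where
  carrier := {a | ∀ t, X.gauge t a = a}
  mul_mem' h h' t := by rw [map_mul, h t, h' t]
  add_mem' h h' t := by rw [map_add, h t, h' t]
  algebraMap_mem' c t := AlgHomClass.commutes (X.gauge t) c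
  star_mem' h t := by rw [map_star, h t]

lemma Phi_zero_apply (a : X.GraphAlg) : X.Phi 0 a = ∫ t, X.gauge t a := by
  simp [Phi, mFourier_zero]

lemma integrable_gauge (a : X.GraphAlg) :
    Integrable (fun t : UnitAddTorus (Fin k) => X.gauge t a) :=
  (X.continuous_gauge a).integrable_of_hasCompactSupport (HasCompactSupport.of_compactSpace _)

lemma Phi_zero_mem_core (a : X.GraphAlg) : X.Phi 0 a ∈ X.core := by
  intro t
  rw [Phi_zero_apply]
  let L : X.GraphAlg →L[ℂ] X.GraphAlg :=
    ⟨(X.gauge t).toAlgHom.toLinearMap, (X.gauge t).continuous_of_cstar⟩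
  have h := L.integral_comp_comm (X.integrable_gauge a)
  have h2 : ∀ u, L (X.gauge u a) = X.gauge (t + u) a := fun u => X.gauge_gauge t u a
  simp only [h2] at h
  rw [integral_add_left_eq_self (fun u => X.gauge u a) t] at h
  exact h.symm

/-- The expectation `Φ_0` onto the core, as a linear map. -/
def expectation : X.GraphAlg →ₗ[ℂ] X.core where
  toFun a := ⟨X.Phi 0 a, X.Phi_zero_mem_core a⟩
  map_add' a b := Subtype.ext <| by
    simp only [Phi_zero_apply, map_add]
    exact integral_add (X.integrable_gauge a) (X.integrable_gauge b)
  map_smul' c a := Subtype.ext <| by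
    simp only [Phi_zero_apply, map_smul]
    exact integral_smul c _

/-- A tracial state on the core. -/
structure IsTracialState (τ : X.core →ₗ[ℂ] ℂ) : Prop where
  map_one : τ 1 = 1
  nonneg : ∀ a, ∃ x : ℝ, 0 ≤ x ∧ τ (star a * a) = x
  tracial : ∀ a b, τ (a * b) = τ (b * a)

open Classical in
/-- The tracial state `τ` of the core (the core is a UHF algebra, so there is exactly one). -/
def trace : X.core →ₗ[ℂ] ℂ :=
  if h : ∃ τ : X.core →ₗ[ℂ] ℂ, X.IsTracialState τ then h.choose else 0

lemma trace_star_mul_self (a : X.core) : 0 ≤ X.trace (star a * a) := by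
  unfold trace
  split_ifs with h
  · obtain ⟨x, hx, he⟩ := h.choose_spec.nonneg a
    rw [he]
    exact Complex.zero_le_real.mpr hx
  · simp

lemma expectation_nonneg {a : X.GraphAlg} (ha : 0 ≤ a) :
    ∃ b : X.core, X.expectation a = star b * b := by
  have hg : ∀ t (c : X.GraphAlg), 0 ≤ c → 0 ≤ X.gauge t c := fun t c hc => map_nonneg (X.gauge t) hc
  have h0 : 0 ≤ X.Phi 0 a := by
    rw [Phi_zero_apply]
    exact integral_nonneg fun t => hg t a ha
  have hs : CFC.sqrt (X.Phi 0 a) ∈ X.core := fun t => by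
    refine (CFC.sqrt_unique ?_ (hg t _ (CFC.sqrt_nonneg _))).symm
    rw [← map_mul, CFC.sqrt_mul_sqrt_self _ h0]
    exact X.Phi_zero_mem_core a t
  refine ⟨⟨_, hs⟩, Subtype.ext ?_⟩
  change X.Phi 0 a = star (CFC.sqrt (X.Phi 0 a)) * CFC.sqrt (X.Phi 0 a)
  rw [(CFC.sqrt_nonneg (X.Phi 0 a)).isSelfAdjoint.star_eq, CFC.sqrt_mul_sqrt_self _ h0]

/-- The distinguished state `ω = τ ∘ Φ_0` of `𝒪_θ`. -/
def omega : X.GraphAlg →ₚ[ℂ] ℂ :=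
  PositiveLinearMap.mk₀ (X.trace ∘ₗ X.expectation) fun a ha => by
    obtain ⟨b, hb⟩ := X.expectation_nonneg ha
    change 0 ≤ X.trace (X.expectation a)
    rw [hb]
    exact X.trace_star_mul_self b

end SingleVertexKGraph

/-! ### Tomita–Takesaki theory for a positive functional on a C⋆-algebra

Unbounded operators on the GNS space are described by their graphs. -/

namespace Modular

variable {A : Type*} [CStarAlgebra A] [PartialOrder A] [StarOrderedRing A] (f : A →ₚ[ℂ] ℂ)

/-- The vector of the GNS space given by `a : A`, that is `π(a)Ω`. -/
def vec (a : A) : f.GNS := ((f.toPreGNS a : f.PreGNS) : f.GNS)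

/-- The graph of the Tomita operator `S`, the closure of `π(a)Ω ↦ π(a⋆)Ω`. -/
def tomitaGraph : Set (f.GNS × f.GNS) := closure (Set.range fun a : A => (vec f a, vec f (star a)))

/-- The graph of the adjoint `F = S⋆` of the antilinear operator `S`:
`⟪S ξ, η⟫ = ⟪F η, ξ⟫` for all `ξ` in the domain of `S`. -/
def tomitaAdjointGraph : Set (f.GNS × f.GNS) :=
  {y | ∀ x ∈ tomitaGraph f, ⟪x.2, y.1⟫_ℂ = ⟪y.2, x.1⟫_ℂ}

/-- The graph of the modular operator `Δ = F S`. -/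
def modularGraph : Set (f.GNS × f.GNS) :=
  {x | ∃ η, (x.1, η) ∈ tomitaGraph f ∧ (η, x.2) ∈ tomitaAdjointGraph f}

open Classical in
/-- The bounded operator `(1 + Δ)⁻¹`. -/
def resolvent : f.GNS →L[ℂ] f.GNS :=
  Classical.epsilon fun T => ∀ ξ η, T ξ = η ↔ (η, ξ - η) ∈ modularGraph f

/-- The continuous function `x (1 - x) ((1 - x) / x)^{it}` on `[0, 1]`. -/
def powerSymbol (t : ℝ) (x : ℝ) : ℂ :=
  (x * (1 - x) : ℝ) * Complex.exp (Complex.I * t * Real.log ((1 - x) / x))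

/-- The unitary `Δ^{it}`. With `T = (1 + Δ)⁻¹`, so that `Δ = (1 - T) T⁻¹`, it is the bounded operator
which satisfies `Δ^{it} T (1 - T) = h(T)` for `h(x) = x (1 - x) ((1 - x) / x)^{it}`, where `h(T)` is
given by the continuous functional calculus; as `Δ` is injective, `T (1 - T)` has dense range. -/
def modularUnitary (t : ℝ) : f.GNS →L[ℂ] f.GNS :=
  Classical.epsilon fun V =>
    V * (resolvent f * (1 - resolvent f)) = cfc (fun z : ℂ => powerSymbol t z.re) (resolvent f)

/-- The modular automorphism `σ_t(x) = Δ^{it} x Δ^{-it}`. -/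
def modularAut (t : ℝ) (x : f.GNS →L[ℂ] f.GNS) : f.GNS →L[ℂ] f.GNS :=
  modularUnitary f t * x * modularUnitary f (-t)

/-- The elements of `A` fixed by the modular automorphism group, `A` being represented on the GNS
space. -/
def fixedPoints : Set A :=
  {a | ∀ t : ℝ, modularAut f t (f.gnsStarAlgHom a) = f.gnsStarAlgHom a}

end Modular

namespace SingleVertexKGraph

variable {k : ℕ} {Λ : Type*} [Monoid Λ] (X : SingleVertexKGraph k Λ)

/-- The C⋆-subalgebra `C⋆(M)` of `𝒪_θ` generated by a set `M` (and the unit). -/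
def cstar (M : Set X.GraphAlg) : StarSubalgebra ℂ X.GraphAlg :=
  (StarAlgebra.adjoin ℂ M).topologicalClosure

/-- `g₊ = g ∨ 0`, as an element of `ℕᵏ`. -/
def posPart (g : Fin k → ℤ) : Fin k → ℕ := fun i => (g i).toNat

/-- `g₋ = (-g) ∨ 0`, as an element of `ℕᵏ`. -/
def negPart (g : Fin k → ℤ) : Fin k → ℕ := fun i => (-g i).toNat

/-- The operator `∑ s_u s_{j(u)}⋆`, the sum running over the words `u` of degree `p`. -/
def exchange {p q : Fin k → ℕ} (j : X.Words p ≃ X.Words q) : X.GraphAlg :=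
  ∑ u, X.s u.1 * star (X.s (j u).1)

end SingleVertexKGraph

end

/-! The heart is the KMS relation of `ω` on monomials. Write `|w|` for the number of words of the
same degree as `w`. Then `ω(s_u s_v⋆ b) = (|v| / |u|) ω(b s_u s_v⋆)` (`omega_mono_mul`), so `π(s_u
s_v⋆)Ω` is an eigenvector of `Δ` with eigenvalue `|v| / |u| = ∏ m_i ^ (-n_i)`, where `n = d(u) -
d(v)`. The monomials span a dense subspace (`closure_span_monomials`). Hence `Δ^{it}` multiplies
vectors of degree `n` by `∏ m_i ^ (-i t n_i)`, which is what the gauge automorphism at the torus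
point `flow t` does. So `σ_t ∘ π = π ∘ γ_{flow t}` (`modularAut_omega`), and since `π` is faithful
(`gns_injective`), the fixed points of `σ` are those of the gauge action along the flow. Applying
`Φ_n` to such a fixed point gives `0` unless `n ∈ G`, and every element lies in the closed span of
its components `Φ_n(a)` (`mem_closure_span_Phi`); this is the first equality.

For the second, `U_p` is a unitary of degree `g_p`, so products of the `U_p` and their adjoints
provide a unitary `U` of every degree in `G`. If `a` has the same degree, then `a U⋆` is in the core
and `a = (a U⋆) U`.

Two objects are defined by choice and need existence proofs. The trace arises as the limit of
averages `a ↦ |Λ^p|⁻¹ ∑ s_u⋆ a s_u`, which on the matrix algebras filling out the core are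
normalised traces; beyond existence, only the tracial state axioms are used. The resolvent `(1 +
Δ)⁻¹` and then `Δ^{it}` are constructed from the dense family of eigenvectors. Both the limit and
the resolvent are extended from a dense subspace by `AddSubgroup.isClosed_image_fst`. -/

noncomputable section

/-! ### Harmonic analysis on the torus -/

instance isProbabilityMeasure_volume_unitAddCircle :
    IsProbabilityMeasure (volume : Measure UnitAddCircle) :=
  ⟨by simp⟩

instance isProbabilityMeasure_volume_unitAddTorus (k : ℕ) :
    IsProbabilityMeasure (volume : Measure (UnitAddTorus (Fin k))) :=
  inferInstanceAs (IsProbabilityMeasure (Measure.pi fun _ => volume))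

lemma norm_mFourier_apply {k : ℕ} (n : Fin k → ℤ) (t : UnitAddTorus (Fin k)) :
    ‖mFourier n t‖ = 1 := by
  simp only [mFourier, ContinuousMap.coe_mk, norm_prod, fourier_apply, Circle.norm_coe,
    Finset.prod_const_one]

lemma integrable_of_continuous_torus {k : ℕ} {E : Type*} [NormedAddCommGroup E]
    {f : UnitAddTorus (Fin k) → E} (hf : Continuous f) : Integrable f :=
  hf.integrable_of_hasCompactSupport (HasCompactSupport.of_compactSpace _)

lemma exists_mFourier_ne_one {k : ℕ} {n : Fin k → ℤ} (hn : n ≠ 0) :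
    ∃ t : UnitAddTorus (Fin k), mFourier n t ≠ 1 := by
  obtain ⟨i, hi⟩ := Function.ne_iff.mp hn
  -- Half a period of the `i`-th factor of the character, where its value is `-1`.
  refine ⟨Pi.single i ((1 / 2 / (n i : ℝ) : ℝ) : UnitAddCircle), ?_⟩
  have h : mFourier n (Pi.single i ((1 / 2 / (n i : ℝ) : ℝ) : UnitAddCircle)) = -1 := by
    simp only [mFourier, ContinuousMap.coe_mk]
    rw [Finset.prod_eq_single i (fun j _ hj => by simp [Pi.single_eq_of_ne hj]) (by simp),
      Pi.single_eq_same]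
    have := fourier_add_half_inv_index (T := 1) hi one_pos 0
    rwa [zero_add, fourier_eval_zero] at this
  rw [h]
  norm_num

/-- Translating by `t` leaves the integral unchanged but multiplies it by the value of the character
at `t`, which can be chosen different from `1`. -/
lemma integral_mFourier {k : ℕ} {n : Fin k → ℤ} (hn : n ≠ 0) :
    ∫ t : UnitAddTorus (Fin k), mFourier n t = 0 := by
  obtain ⟨t, ht⟩ := exists_mFourier_ne_one hn
  have h := integral_add_left_eq_self (μ := (volume : Measure (UnitAddTorus (Fin k))))
    (fun u => mFourier n u) t
  simp only [SingleVertexKGraph.mFourier_add_right] at h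
  rw [integral_const_mul] at h
  have : (mFourier n t - 1) * ∫ t : UnitAddTorus (Fin k), mFourier n t = 0 := by
    linear_combination h
  exact (mul_eq_zero.mp this).resolve_left (sub_ne_zero.mpr ht)

/-- A continuous function on the torus whose Fourier coefficients all vanish is zero. -/
lemma eq_zero_of_integral_mFourier_mul {k : ℕ} (f : C(UnitAddTorus (Fin k), ℂ))
    (h : ∀ n, ∫ t, mFourier n t * f t = 0) : f = 0 := by
  let I : C(UnitAddTorus (Fin k), ℂ) → ℂ := fun g => ∫ t, g t * f t
  have hint : ∀ g : C(UnitAddTorus (Fin k), ℂ), Integrable fun t => g t * f t := fun g =>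
    integrable_of_continuous_torus (by fun_prop)
  have hlip : LipschitzWith ‖f‖₊ I := by
    refine LipschitzWith.of_dist_le_mul fun g g' => ?_
    simp only [I, dist_eq_norm]
    rw [← integral_sub (hint g) (hint g')]
    refine (norm_integral_le_of_norm_le_const (C := ‖f‖ * ‖g - g'‖)
      (Filter.Eventually.of_forall fun t => ?_)).trans ?_
    · rw [← sub_mul, norm_mul, mul_comm]
      exact mul_le_mul (f.norm_coe_le_norm t) ((g - g').norm_coe_le_norm t) (norm_nonneg _)
        (norm_nonneg _)
    · simp
  let K : Submodule ℂ C(UnitAddTorus (Fin k), ℂ) :=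
    { carrier := {g | I g = 0}
      zero_mem' := by simp [I]
      add_mem' := fun {a b} ha hb => by
        simp only [Set.mem_ofPred_eq, I] at *
        simp only [ContinuousMap.add_apply, add_mul]
        rw [integral_add (hint a) (hint b), ha, hb, add_zero]
      smul_mem' := fun c a ha => by
        simp only [Set.mem_ofPred_eq, I] at *
        simp only [ContinuousMap.smul_apply, smul_mul_assoc]
        rw [integral_smul, ha, smul_zero] }
  have hK : IsClosed (K : Set C(UnitAddTorus (Fin k), ℂ)) :=
    isClosed_eq hlip.continuous continuous_const
  have hspan : Submodule.span ℂ (Set.range (mFourier (d := Fin k))) ≤ K := by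
    rw [Submodule.span_le]
    rintro _ ⟨n, rfl⟩
    exact h n
  have htop := Submodule.topologicalClosure_minimal _ hspan hK
  rw [span_mFourier_closure_eq_top] at htop
  -- Trigonometric polynomials are dense, so the pairing with `f` vanishes identically; pairing with
  -- `star f` gives the square of the `L²` norm.
  have h0 : ∫ t, star (f t) * f t = 0 := htop (Submodule.mem_top (x := star f))
  have h1 : ∫ t, ‖f t‖ ^ 2 = (0 : ℝ) := by
    have : ∀ t, star (f t) * f t = ((‖f t‖ ^ 2 : ℝ) : ℂ) := fun t => by
      rw [Complex.star_def, Complex.conj_mul']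
      push_cast
      rfl
    simp only [this, integral_complex_ofReal] at h0
    exact_mod_cast h0
  have h2 := (integral_eq_zero_iff_of_nonneg
    (μ := (volume : Measure (UnitAddTorus (Fin k)))) (f := fun t => ‖f t‖ ^ 2)
    (fun t => by positivity) (integrable_of_continuous_torus (by fun_prop))).mp h1
  have h3 := (Continuous.ae_eq_iff_eq _ (by fun_prop) continuous_zero).mp h2
  ext t
  simpa using congrFun h3 t

namespace SingleVertexKGraph

variable {k : ℕ} {Λ : Type*} [Monoid Λ] (X : SingleVertexKGraph k Λ)

/-! ### Words -/

/-- `ℕᵏ` is generated by the `ε_i`, so a property of degrees stable under concatenation need only be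
checked on the empty word and on edges. -/
lemma degree_induction {P : (Fin k → ℕ) → Prop} (h0 : P 0) (h1 : ∀ i, P (Pi.single i 1))
    (hadd : ∀ p q, P p → P q → P (p + q)) (p : Fin k → ℕ) : P p := by
  rw [← Finset.univ_sum_single p]
  refine Finset.sum_induction _ P hadd h0 fun i _ => ?_
  induction p i with
  | zero => simpa using h0
  | succ n ih =>
    rw [Pi.single_add]
    exact hadd _ _ ih (h1 i)

/-- Concatenation of words, as a bijection. -/
def concat (p q : Fin k → ℕ) : X.Words p × X.Words q ≃ X.Words (p + q) :=
  Equiv.ofBijective (fun x => ⟨x.1.1 * x.2.1, by rw [X.deg_mul, x.1.2, x.2.2]⟩) <| by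
    constructor
    · rintro ⟨a, b⟩ ⟨c, d⟩ h
      have h : a.1 * b.1 = c.1 * d.1 := congrArg Subtype.val h
      have hu := X.factorization (a.1 * b.1) p q (by rw [X.deg_mul, a.2, b.2])
      have := hu.unique (y₁ := (a.1, b.1)) (y₂ := (c.1, d.1)) ⟨rfl, a.2, b.2⟩ ⟨h, c.2, d.2⟩
      exact Prod.ext (Subtype.ext (congrArg Prod.fst this)) (Subtype.ext (congrArg Prod.snd this))
    · intro w
      obtain ⟨x, ⟨h1, h2, h3⟩, -⟩ := X.factorization w.1 p q w.2
      exact ⟨(⟨x.1, h2⟩, ⟨x.2, h3⟩), Subtype.ext h1.symm⟩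

@[simp] lemma concat_coe (p q : Fin k → ℕ) (x : X.Words p × X.Words q) :
    (X.concat p q x).1 = x.1.1 * x.2.1 := rfl

lemma eq_one_of_deg_eq_zero {w : Λ} (hw : X.deg w = 0) : w = 1 := by
  by_contra h
  obtain ⟨i, e, v, -, h2⟩ := X.exists_edge_mul w h
  simp [hw] at h2

/-- The empty word is the only word of degree zero. -/
instance uniqueWordsZero : Unique (X.Words 0) where
  default := ⟨1, X.deg_one⟩
  uniq w := Subtype.ext (X.eq_one_of_deg_eq_zero w.2)

lemma default_words_zero : (default : X.Words 0).1 = 1 := rfl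

lemma card_words (p : Fin k → ℕ) : Fintype.card (X.Words p) = ∏ i, X.numEdges i ^ p i := by
  induction p using degree_induction with
  | h0 => simp
  | h1 i =>
    rw [Finset.prod_eq_single i (fun j _ hj => by simp [hj]) (by simp)]
    simp [numEdges]
  | hadd p q hp hq =>
    rw [← Fintype.card_congr (X.concat p q), Fintype.card_prod, hp, hq, ← Finset.prod_mul_distrib]
    simp [pow_add]

lemma sum_s_mul_star (p : Fin k → ℕ) : ∑ u : X.Words p, X.s u.1 * star (X.s u.1) = 1 := by
  induction p using degree_induction with
  | h0 =>
    rw [Fintype.sum_unique]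
    simp [default_words_zero]
  | h1 i => exact X.isCuntzType_s.sum_eq_one i
  | hadd p q hp hq =>
    rw [← (X.concat p q).sum_comp, Fintype.sum_prod_type]
    simp only [concat_coe, map_mul, star_mul]
    have : ∀ u : X.Words p, ∑ v : X.Words q,
        X.s u.1 * X.s v.1 * (star (X.s v.1) * star (X.s u.1)) = X.s u.1 * star (X.s u.1) := by
      intro u
      calc _ = X.s u.1 * (∑ v : X.Words q, X.s v.1 * star (X.s v.1)) * star (X.s u.1) := by
            simp only [Finset.mul_sum, Finset.sum_mul, mul_assoc]
        _ = _ := by rw [hq, mul_one]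
    simp only [this, hp]

lemma star_s_mul_self (w : Λ) : star (X.s w) * X.s w = 1 := X.isCuntzType_s.star_mul_self w

lemma star_s_mul_of_ne (p : Fin k → ℕ) (u v : X.Words p) (h : u ≠ v) :
    star (X.s u.1) * X.s v.1 = 0 := by
  induction p using degree_induction with
  | h0 => exact (h (Subsingleton.elim _ _)).elim
  | h1 i => exact X.isCuntzType_s.orthogonal i u v h
  | hadd p q hp hq =>
    obtain ⟨⟨a, b⟩, rfl⟩ := (X.concat p q).surjective u
    obtain ⟨⟨c, d⟩, rfl⟩ := (X.concat p q).surjective v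
    simp only [concat_coe, map_mul, star_mul]
    rw [mul_assoc, ← mul_assoc (star (X.s a.1))]
    by_cases hac : a = c
    · subst hac
      rw [X.star_s_mul_self, one_mul]
      exact hq b d fun hbd => h (by rw [hbd])
    · rw [hp a c hac, zero_mul, mul_zero]

open Classical in
lemma star_s_mul_s {p : Fin k → ℕ} (u v : X.Words p) :
    star (X.s u.1) * X.s v.1 = if u = v then 1 else 0 := by
  split_ifs with h
  · rw [h, X.star_s_mul_self]
  · exact X.star_s_mul_of_ne p u v h

/-! ### Density of the span of the monomials `s_u s_v⋆` -/

/-- The element `s_u s_v⋆`. -/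
def mono (u v : Λ) : X.GraphAlg := X.s u * star (X.s v)

lemma star_mono (u v : Λ) : star (X.mono u v) = X.mono v u := by simp [mono]

/-- The set of all `s_u s_v⋆`. -/
def monomials : Set X.GraphAlg := Set.range fun x : Λ × Λ => X.mono x.1 x.2

lemma mono_mem_span (u v : Λ) : X.mono u v ∈ Submodule.span ℂ X.monomials :=
  Submodule.subset_span ⟨(u, v), rfl⟩

/-- Insert `1 = ∑ s_x s_x⋆`, over `x` of degree `d(w)`, between `s_u` and `s_v⋆`. Then `u x` is long
enough to be refactored as `a b` with `d(a) = d(w)`, and `s_w⋆ s_a` is `0` or `1`. -/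
lemma star_s_mul_mono_mem (w u v : Λ) :
    star (X.s w) * X.mono u v ∈ Submodule.span ℂ X.monomials := by
  have h : star (X.s w) * X.mono u v =
      ∑ x : X.Words (X.deg w), star (X.s w) * X.s (u * x.1) * star (X.s (v * x.1)) := by
    calc star (X.s w) * X.mono u v = star (X.s w) * (X.s u *
          (∑ x : X.Words (X.deg w), X.s x.1 * star (X.s x.1)) * star (X.s v)) := by
          rw [X.sum_s_mul_star, mul_one, mono]
      _ = _ := by simp only [Finset.mul_sum, Finset.sum_mul, mul_assoc, map_mul, star_mul]
  rw [h]
  refine Submodule.sum_mem _ fun x _ => ?_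
  obtain ⟨⟨a, b⟩, hab⟩ := (X.concat (X.deg w) (X.deg u)).surjective
    ⟨u * x.1, by rw [X.deg_mul, x.2, add_comm]⟩
  have hab : a.1 * b.1 = u * x.1 := congrArg Subtype.val hab
  rw [← hab, map_mul, ← mul_assoc]
  by_cases hwa : ⟨w, rfl⟩ = a
  · subst hwa
    rw [X.star_s_mul_self, one_mul]
    exact X.mono_mem_span _ _
  · rw [X.star_s_mul_of_ne _ _ _ hwa, zero_mul, zero_mul]
    exact zero_mem _

/-- The elements `a` for which both `a` and `a⋆` multiply the closed span `N` into itself form a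
closed ⋆-subalgebra. It contains the generators, so it is everything, and `a = a * 1 ∈ N`. -/
lemma closure_span_monomials : (Submodule.span ℂ X.monomials).topologicalClosure = ⊤ := by
  set N := (Submodule.span ℂ X.monomials).topologicalClosure with hN
  have hNc : IsClosed (N : Set X.GraphAlg) := Submodule.isClosed_topologicalClosure _
  have hleft : ∀ a : X.GraphAlg, (∀ u v, a * X.mono u v ∈ N) → ∀ b ∈ N, a * b ∈ N := by
    intro a ha
    have hle : N ≤ N.comap (LinearMap.mulLeft ℂ a) := by
      refine Submodule.topologicalClosure_minimal _ ?_ (hNc.preimage (by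
        change Continuous fun b => a * b
        fun_prop))
      rw [Submodule.span_le]
      rintro _ ⟨⟨u, v⟩, rfl⟩
      exact ha u v
    exact hle
  have key : ∀ a : X.GraphAlg, (∀ b ∈ N, a * b ∈ N) ∧ ∀ b ∈ N, star a * b ∈ N := by
    intro a
    induction a using GraphAlg.induction with
    | hP =>
      simp only [Set.ofPred_and, Set.ofPred_forall]
      refine IsClosed.inter ?_ ?_ <;> refine isClosed_iInter fun b => isClosed_iInter fun _ => ?_
      · exact hNc.preimage (by fun_prop)
      · exact hNc.preimage (by fun_prop)
    | hs w =>
      refine ⟨hleft _ fun u v => ?_, hleft _ fun u v => ?_⟩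
      · refine Submodule.le_topologicalClosure _ ?_
        rw [mono, ← mul_assoc, ← map_mul]
        exact X.mono_mem_span _ _
      · exact Submodule.le_topologicalClosure _ (X.star_s_mul_mono_mem w u v)
    | hc c =>
      simp only [Algebra.algebraMap_eq_smul_one, star_smul, star_one, smul_mul_assoc, one_mul]
      exact ⟨fun b hb => N.smul_mem _ hb, fun b hb => N.smul_mem _ hb⟩
    | ha a b h1 h2 =>
      simp only [star_add, add_mul]
      exact ⟨fun c hc => N.add_mem (h1.1 c hc) (h2.1 c hc),
        fun c hc => N.add_mem (h1.2 c hc) (h2.2 c hc)⟩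
    | hm a b h1 h2 =>
      simp only [star_mul, mul_assoc]
      exact ⟨fun c hc => h1.1 _ (h2.1 c hc), fun c hc => h2.2 _ (h1.2 c hc)⟩
    | hst a h =>
      rw [star_star]
      exact ⟨h.2, h.1⟩
  rw [eq_top_iff]
  rintro a -
  have h1 : (1 : X.GraphAlg) ∈ N := by
    refine Submodule.le_topologicalClosure _ ?_
    have := X.mono_mem_span 1 1
    simpa [mono] using this
  simpa using (key a).1 1 h1

/-- Two continuous linear maps which agree on all `s_u s_v⋆` are equal. -/
lemma eq_of_eq_on_mono {E : Type*} [AddCommGroup E] [Module ℂ E] [TopologicalSpace E] [T2Space E]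
    {f g : X.GraphAlg →ₗ[ℂ] E} (hf : Continuous f) (hg : Continuous g)
    (h : ∀ u v, f (X.mono u v) = g (X.mono u v)) (a : X.GraphAlg) : f a = g a := by
  have hle : Submodule.span ℂ X.monomials ≤ LinearMap.eqLocus f g := by
    rw [Submodule.span_le]
    rintro _ ⟨⟨u, v⟩, rfl⟩
    exact h u v
  have htop := Submodule.topologicalClosure_minimal _ hle (isClosed_eq hf hg)
  rw [X.closure_span_monomials] at htop
  exact htop (Submodule.mem_top (x := a))

/-! ### Spectral subspaces of the gauge action -/

lemma gauge_mono (t : UnitAddTorus (Fin k)) (u v : Λ) :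
    X.gauge t (X.mono u v) = mFourier (X.zdeg u - X.zdeg v) t • X.mono u v := by
  rw [mono, map_mul, map_star, gauge_s, gauge_s, star_smul, smul_mul_smul_comm, sub_eq_add_neg,
    mFourier_add, mFourier_neg, Complex.star_def]

lemma gauge_zero (a : X.GraphAlg) : X.gauge 0 a = a := by
  induction a using GraphAlg.induction with
  | hP => exact isClosed_eq (X.gauge 0).continuous_of_cstar continuous_id
  | hs w => simp [gauge_s, mFourier]
  | hc c => simp only [AlgHomClass.commutes]
  | ha a b h1 h2 => simp only [map_add, h1, h2]
  | hm a b h1 h2 => simp only [map_mul, h1, h2]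
  | hst a h => rw [map_star, h]

lemma norm_gauge_le (t : UnitAddTorus (Fin k)) (a : X.GraphAlg) : ‖X.gauge t a‖ ≤ ‖a‖ :=
  NonUnitalStarAlgHom.norm_apply_le (X.gauge t) a

lemma integrable_Phi (n : Fin k → ℤ) (a : X.GraphAlg) :
    Integrable fun t : UnitAddTorus (Fin k) => mFourier (-n) t • X.gauge t a :=
  integrable_of_continuous_torus (by have := X.continuous_gauge a; fun_prop)

/-- `Φ_n` as a continuous linear map. -/
def PhiL (n : Fin k → ℤ) : X.GraphAlg →L[ℂ] X.GraphAlg :=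
  LinearMap.mkContinuous
    { toFun := X.Phi n
      map_add' := fun a b => by
        simp only [Phi, map_add, smul_add]
        exact integral_add (X.integrable_Phi n a) (X.integrable_Phi n b)
      map_smul' := fun c a => by
        simp only [Phi, map_smul, RingHom.id_apply, smul_comm _ c]
        exact integral_smul c _ } 1 fun a => by
    refine (norm_integral_le_of_norm_le_const (C := ‖a‖) (Filter.Eventually.of_forall fun t => ?_)).trans ?_
    · rw [norm_smul, norm_mFourier_apply, one_mul]
      exact X.norm_gauge_le t a
    · simp

/-- `a` is an eigenvector of the gauge action with character `n`. -/
def IsHomog (a : X.GraphAlg) (n : Fin k → ℤ) : Prop := ∀ t, X.gauge t a = mFourier n t • a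

lemma gauge_Phi (t : UnitAddTorus (Fin k)) (n : Fin k → ℤ) (a : X.GraphAlg) :
    X.gauge t (X.Phi n a) = mFourier n t • X.Phi n a := by
  let L : X.GraphAlg →L[ℂ] X.GraphAlg :=
    ⟨(X.gauge t).toAlgHom.toLinearMap, (X.gauge t).continuous_of_cstar⟩
  have h := L.integral_comp_comm (X.integrable_Phi n a)
  have h2 : ∀ u, L (mFourier (-n) u • X.gauge u a) =
      mFourier n t • (mFourier (-n) (t + u) • X.gauge (t + u) a) := fun u => by
    rw [map_smul, smul_smul, mFourier_add_right, ← mul_assoc, ← mFourier_add, add_neg_cancel,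
      mFourier_zero, ContinuousMap.one_apply, one_mul]
    exact congrArg _ (X.gauge_gauge t u a)
  simp only [h2] at h
  rw [integral_smul, integral_add_left_eq_self (fun u => mFourier (-n) u • X.gauge u a) t] at h
  exact h.symm

lemma Phi_gauge (t : UnitAddTorus (Fin k)) (n : Fin k → ℤ) (a : X.GraphAlg) :
    X.Phi n (X.gauge t a) = mFourier n t • X.Phi n a := by
  have h2 : ∀ u, mFourier (-n) u • X.gauge u (X.gauge t a) =
      mFourier n t • (mFourier (-n) (u + t) • X.gauge (u + t) a) := fun u => by
    rw [smul_smul, mFourier_add_right, mul_comm (mFourier (-n) u), ← mul_assoc, ← mFourier_add,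
      add_neg_cancel, mFourier_zero, ContinuousMap.one_apply, one_mul, X.gauge_gauge]
  simp only [Phi, h2]
  rw [integral_smul, integral_add_right_eq_self (fun u => mFourier (-n) u • X.gauge u a) t]

variable {X}

lemma IsHomog.Phi_self {a : X.GraphAlg} {n : Fin k → ℤ} (h : X.IsHomog a n) : X.Phi n a = a := by
  have h2 : ∀ t, mFourier (-n) t • X.gauge t a = a := fun t => by
    rw [h t, smul_smul, ← mFourier_add, neg_add_cancel, mFourier_zero, ContinuousMap.one_apply,
      one_smul]
  simp [Phi, h2]

lemma IsHomog.Phi_of_ne {a : X.GraphAlg} {n m : Fin k → ℤ} (h : X.IsHomog a n) (hm : m ≠ n) :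
    X.Phi m a = 0 := by
  have h2 : ∀ t, mFourier (-m) t • X.gauge t a = mFourier (n - m) t • a := fun t => by
    rw [h t, smul_smul, ← mFourier_add, neg_add_eq_sub]
  simp only [Phi, h2]
  rw [integral_smul_const, integral_mFourier (sub_ne_zero.mpr hm.symm), zero_smul]

/-- `Φ_n` is a projection onto the eigenspace of the character `n`; degrees are handled below
through the eigenvalue equation. -/
lemma hasDegree_iff {a : X.GraphAlg} {n : Fin k → ℤ} : X.HasDegree a n ↔ X.IsHomog a n := by
  constructor
  · rintro ⟨b, rfl⟩ t
    exact X.gauge_Phi t n b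
  · exact fun h => ⟨a, h.Phi_self⟩

lemma IsHomog.mul {a b : X.GraphAlg} {n m : Fin k → ℤ} (ha : X.IsHomog a n) (hb : X.IsHomog b m) :
    X.IsHomog (a * b) (n + m) := fun t => by
  rw [map_mul, ha t, hb t, smul_mul_smul_comm, mFourier_add]

lemma IsHomog.star {a : X.GraphAlg} {n : Fin k → ℤ} (ha : X.IsHomog a n) :
    X.IsHomog (star a) (-n) := fun t => by
  rw [map_star, ha t, star_smul, mFourier_neg, Complex.star_def]

variable (X)

lemma isHomog_mono (u v : Λ) : X.IsHomog (X.mono u v) (X.zdeg u - X.zdeg v) :=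
  fun t => X.gauge_mono t u v

lemma mem_core_iff {a : X.GraphAlg} : a ∈ X.core ↔ X.IsHomog a 0 := by
  simp only [IsHomog, mFourier_zero, ContinuousMap.one_apply, one_smul]
  rfl

/-- Every element lies in the closed subspace spanned by its homogeneous components. -/
lemma mem_closure_span_Phi (a : X.GraphAlg) :
    a ∈ (Submodule.span ℂ (Set.range fun n => X.Phi n a)).topologicalClosure := by
  set N := (Submodule.span ℂ (Set.range fun n => X.Phi n a)).topologicalClosure
  have : IsClosed (N : Set X.GraphAlg) := Submodule.isClosed_topologicalClosure _
  by_contra ha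
  -- Hahn–Banach on the quotient by `N`: a functional killing every `Φ_n(a)` but not `a`.
  obtain ⟨f, hf⟩ := SeparatingDual.exists_ne_zero (R := ℂ) (x := N.mkQL a)
    (by simpa [Submodule.Quotient.mk_eq_zero] using ha)
  let L : X.GraphAlg →L[ℂ] ℂ := f.comp N.mkQL
  have hL : ∀ n, L (X.Phi n a) = 0 := fun n => by
    have : X.Phi n a ∈ N := Submodule.le_topologicalClosure _ (Submodule.subset_span ⟨n, rfl⟩)
    simp [L, (Submodule.Quotient.mk_eq_zero N).mpr this]
  have hc := X.continuous_gauge a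
  -- The Fourier coefficients of `t ↦ L (γ_t a)` are the numbers `L (Φ_{-n} a) = 0`, so this
  -- function vanishes, in particular at `t = 0`.
  have h0 := eq_zero_of_integral_mFourier_mul ⟨fun t => L (X.gauge t a), by fun_prop⟩ fun n => by
    have h := L.integral_comp_comm (X.integrable_Phi (-n) a)
    simp only [neg_neg, map_smul, smul_eq_mul] at h
    exact h.trans (by simpa [Phi] using hL (-n))
  have h1 := congrArg (fun g : C(UnitAddTorus (Fin k), ℂ) => g 0) h0
  simp only [ContinuousMap.coe_mk, gauge_zero, ContinuousMap.zero_apply] at h1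
  exact hf h1

lemma eq_zero_of_Phi_eq_zero {a : X.GraphAlg} (h : ∀ n, X.Phi n a = 0) : a = 0 := by
  have h1 := X.mem_closure_span_Phi a
  have h2 : (Set.range fun n => X.Phi n a) ⊆ {0} := by
    rintro _ ⟨n, rfl⟩
    exact h n
  have h3 := Submodule.topologicalClosure_mono (Submodule.span_mono (R := ℂ) h2) h1
  rw [Submodule.span_zero_singleton] at h3
  rwa [← Submodule.mem_bot ℂ, ← (isClosed_singleton (x := (0 : X.GraphAlg))).submodule_topologicalClosure_eq
    (s := (⊥ : Submodule ℂ X.GraphAlg))]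

end SingleVertexKGraph

open Filter Topology in
/-- The projection to the first factor of a closed subgroup on which the second coordinate is
controlled by the first one is closed. -/
lemma AddSubgroup.isClosed_image_fst {E F : Type*} [NormedAddCommGroup E] [NormedAddCommGroup F]
    [CompleteSpace F] (Z : AddSubgroup (E × F)) (hZ : IsClosed (Z : Set (E × F)))
    (h : ∀ z ∈ Z, ‖z.2‖ ≤ ‖z.1‖) : IsClosed (Prod.fst '' (Z : Set (E × F))) := by
  refine IsSeqClosed.isClosed fun x a hx ha => ?_
  choose z hz hzx using hx
  -- The bound applied to differences in `Z` makes the second coordinates Cauchy along with the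
  -- first.
  have hc : CauchySeq fun n => (z n).2 := by
    have hx : CauchySeq x := ha.cauchySeq
    rw [Metric.cauchySeq_iff] at hx ⊢
    intro ε hε
    obtain ⟨N, hN⟩ := hx ε hε
    refine ⟨N, fun m hm n hn => lt_of_le_of_lt ?_ (hN m hm n hn)⟩
    rw [dist_eq_norm, dist_eq_norm, ← hzx, ← hzx]
    exact h _ (Z.sub_mem (hz m) (hz n))
  obtain ⟨b, hb⟩ := cauchySeq_tendsto_of_complete hc
  have hlim : Tendsto z atTop (𝓝 (a, b)) := by
    have h1 : Tendsto (fun n => (z n).1) atTop (𝓝 a) := by simpa only [hzx] using ha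
    exact h1.prodMk_nhds hb
  exact ⟨(a, b), hZ.mem_of_tendsto hlim (Eventually.of_forall hz), rfl⟩

namespace SingleVertexKGraph

variable {k : ℕ} {Λ : Type*} [Monoid Λ] (X : SingleVertexKGraph k Λ)

/-! ### The filtration of the core by matrix algebras -/

/-- With `s_u⋆ a s_v` as matrix entries of `a`, inserting `1 = ∑ s_w s_w⋆` is matrix multiplication.
-/
lemma sum_compress (p : Fin k → ℕ) (a b : X.GraphAlg) (u v : Λ) :
    star (X.s u) * (a * b) * X.s v =
      ∑ w : X.Words p, (star (X.s u) * a * X.s w.1) * (star (X.s w.1) * b * X.s v) := by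
  calc star (X.s u) * (a * b) * X.s v
      = star (X.s u) * a * (∑ w : X.Words p, X.s w.1 * star (X.s w.1)) * (b * X.s v) := by
        rw [X.sum_s_mul_star, mul_one]
        simp only [mul_assoc]
    _ = _ := by simp only [Finset.mul_sum, Finset.sum_mul, mul_assoc]

/-- The matrix algebra spanned by the `s_u s_v⋆` with `u`, `v` of degree `p`, described by its
matrix entries being scalar. -/
def level (p : Fin k → ℕ) : StarSubalgebra ℂ X.GraphAlg where
  carrier := {b | ∀ u v : X.Words p, ∃ c : ℂ, star (X.s u.1) * b * X.s v.1 = c • 1}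
  mul_mem' := fun {a b} ha hb u v => by
    choose c hc using ha
    choose d hd using hb
    refine ⟨∑ w, c u w * d w v, ?_⟩
    rw [X.sum_compress p, Finset.sum_smul]
    refine Finset.sum_congr rfl fun w _ => ?_
    rw [hc, hd, smul_mul_smul_comm, one_mul]
  add_mem' := fun {a b} ha hb u v => by
    obtain ⟨c, hc⟩ := ha u v
    obtain ⟨d, hd⟩ := hb u v
    exact ⟨c + d, by rw [mul_add, add_mul, hc, hd, add_smul]⟩
  algebraMap_mem' c u v := by
    classical
    refine ⟨c * if u = v then 1 else 0, ?_⟩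
    rw [Algebra.algebraMap_eq_smul_one, mul_smul_comm, mul_one, smul_mul_assoc, X.star_s_mul_s]
    split_ifs <;> simp
  star_mem' := fun {a} ha u v => by
    obtain ⟨c, hc⟩ := ha v u
    refine ⟨star c, ?_⟩
    have := congrArg star hc
    simpa [mul_assoc] using this

lemma isClosed_setOf_scalar : IsClosed {a : X.GraphAlg | ∃ c : ℂ, a = c • 1} := by
  have : {a : X.GraphAlg | ∃ c : ℂ, a = c • 1} = (Submodule.span ℂ {(1 : X.GraphAlg)} : Set _) := by
    ext a
    simp [Submodule.mem_span_singleton, eq_comm]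
  rw [this]
  exact Submodule.closed_of_finiteDimensional _

instance isClosed_level (p : Fin k → ℕ) : IsClosed (X.level p : Set X.GraphAlg) := by
  change IsClosed {b : X.GraphAlg | ∀ u v : X.Words p, ∃ c : ℂ, star (X.s u.1) * b * X.s v.1 = c • 1}
  simp only [Set.ofPred_forall]
  exact isClosed_iInter fun u => isClosed_iInter fun v =>
    X.isClosed_setOf_scalar.preimage (f := fun b => star (X.s u.1) * b * X.s v.1) (by fun_prop)

/-- This is the embedding `b ↦ b ⊗ 1` of matrix algebras: the entry at `(u x, v y)` is that at `(u,
v)` times `s_x⋆ s_y`. It makes the family of levels directed. -/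
lemma level_le_add_right (p q : Fin k → ℕ) : X.level p ≤ X.level (p + q) := by
  intro b hb u v
  obtain ⟨⟨u, x⟩, rfl⟩ := (X.concat p q).surjective u
  obtain ⟨⟨v, y⟩, rfl⟩ := (X.concat p q).surjective v
  obtain ⟨c, hc⟩ := hb u v
  classical
  refine ⟨c * if x = y then 1 else 0, ?_⟩
  calc star (X.s (X.concat p q (u, x)).1) * b * X.s (X.concat p q (v, y)).1
      = star (X.s x.1) * (star (X.s u.1) * b * X.s v.1) * X.s y.1 := by
        simp only [concat_coe, map_mul, star_mul, mul_assoc]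
    _ = _ := by
        rw [hc, mul_smul_comm, mul_one, smul_mul_assoc, X.star_s_mul_s]
        split_ifs <;> simp

lemma eq_sum_compress (p : Fin k → ℕ) (b : X.GraphAlg) :
    b = ∑ u : X.Words p, ∑ v : X.Words p,
      X.s u.1 * (star (X.s u.1) * b * X.s v.1) * star (X.s v.1) := by
  calc b = (∑ u : X.Words p, X.s u.1 * star (X.s u.1)) * b *
        (∑ v : X.Words p, X.s v.1 * star (X.s v.1)) := by
        rw [X.sum_s_mul_star, one_mul, mul_one]
    _ = _ := by
        rw [Finset.sum_mul, Finset.sum_mul]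
        simp only [Finset.mul_sum, mul_assoc]

lemma mono_mem_level {p : Fin k → ℕ} (u v : X.Words p) : X.mono u.1 v.1 ∈ X.level p := by
  intro x y
  classical
  refine ⟨(if x = u then 1 else 0) * if v = y then 1 else 0, ?_⟩
  rw [mono, ← mul_assoc, mul_assoc _ _ (X.s y.1), X.star_s_mul_s, X.star_s_mul_s]
  split_ifs <;> simp

/-- The union of the matrix algebras in the core. -/
def levels : StarSubalgebra ℂ X.GraphAlg where
  carrier := {b | ∃ p, b ∈ X.level p}
  mul_mem' := by
    rintro a b ⟨p, hp⟩ ⟨q, hq⟩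
    exact ⟨p + q, mul_mem (X.level_le_add_right p q hp) (add_comm q p ▸ X.level_le_add_right q p hq)⟩
  add_mem' := by
    rintro a b ⟨p, hp⟩ ⟨q, hq⟩
    exact ⟨p + q, add_mem (X.level_le_add_right p q hp) (add_comm q p ▸ X.level_le_add_right q p hq)⟩
  algebraMap_mem' c := ⟨0, algebraMap_mem _ c⟩
  star_mem' := by
    rintro a ⟨p, hp⟩
    exact ⟨p, star_mem hp⟩

lemma zdeg_injective {u v : Λ} (h : X.zdeg u = X.zdeg v) : X.deg u = X.deg v := by
  funext i
  have := congrFun h i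
  simpa [zdeg] using this

/-- `Φ_0` kills `s_u s_v⋆` if `d(u) ≠ d(v)` and otherwise fixes it, when it lies in a level. By
density `Φ_0` maps everything into the closure of the levels, and it fixes the core. -/
lemma core_le_closure_levels : X.core ≤ X.levels.topologicalClosure := by
  intro a ha
  have hPhi : X.PhiL 0 a = a := ((X.mem_core_iff).mp ha).Phi_self
  have hcl : IsClosed (X.levels.topologicalClosure : Set X.GraphAlg) :=
    StarSubalgebra.isClosed_topologicalClosure _
  have hle : Submodule.span ℂ X.monomials ≤
      X.levels.topologicalClosure.toSubalgebra.toSubmodule.comap (X.PhiL 0).toLinearMap := by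
    rw [Submodule.span_le]
    rintro _ ⟨⟨u, v⟩, rfl⟩
    change X.Phi 0 (X.mono u v) ∈ X.levels.topologicalClosure
    by_cases h : X.zdeg u = X.zdeg v
    · have h0 := X.isHomog_mono u v
      rw [h, sub_self] at h0
      rw [h0.Phi_self]
      exact StarSubalgebra.le_topologicalClosure _
        ⟨X.deg v, X.mono_mem_level ⟨u, X.zdeg_injective h⟩ ⟨v, rfl⟩⟩
    · rw [(X.isHomog_mono u v).Phi_of_ne (sub_ne_zero.mpr h).symm]
      exact zero_mem _
  have h2 := Submodule.topologicalClosure_minimal _ hle (hcl.preimage (X.PhiL 0).continuous)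
  rw [X.closure_span_monomials] at h2
  have h3 : X.PhiL 0 a ∈ X.levels.topologicalClosure := h2 (Submodule.mem_top (x := a))
  rwa [hPhi] at h3

/-- A ⋆-homomorphism to a nonzero C⋆-algebra is isometric on the core. -/
lemma norm_map_of_mem_core {B : Type*} [CStarAlgebra B] [Nontrivial B] (φ : X.GraphAlg →⋆ₐ[ℂ] B)
    {a : X.GraphAlg} (ha : a ∈ X.core) : ‖φ a‖ = ‖a‖ := by
  -- If `φ b = 0`, each scalar matrix entry of `b` is a multiple of `1` sent to `0` in a nonzero
  -- algebra, hence is zero.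
  have hinj : ∀ p, Function.Injective (φ.comp (X.level p).subtype) := by
    intro p
    rw [injective_iff_map_eq_zero]
    rintro ⟨b, hb⟩ h
    have h : φ b = 0 := h
    have hz : ∀ u v : X.Words p, star (X.s u.1) * b * X.s v.1 = 0 := by
      intro u v
      obtain ⟨c, hc⟩ := hb u v
      have h1 := congrArg φ hc
      rw [map_mul, map_mul, h, mul_zero, zero_mul, map_smul, map_one] at h1
      have : c = 0 := by
        rcases smul_eq_zero.mp h1.symm with h2 | h2
        · exact h2
        · exact (one_ne_zero h2).elim
      rw [hc, this, zero_smul]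
    refine Subtype.ext ?_
    change b = 0
    rw [X.eq_sum_compress p b]
    simp [hz]
  -- Injective ⋆-homomorphisms of C⋆-algebras are isometric, and equality of norms passes to the
  -- closure.
  have hlev : ∀ b ∈ X.levels, ‖φ b‖ = ‖b‖ := by
    rintro b ⟨p, hp⟩
    exact NonUnitalStarAlgHom.norm_map (φ.comp (X.level p).subtype) (hinj p) ⟨b, hp⟩
  have hcl : IsClosed {b : X.GraphAlg | ‖φ b‖ = ‖b‖} :=
    isClosed_eq φ.continuous_of_cstar.norm continuous_norm
  exact closure_minimal (s := (X.levels : Set X.GraphAlg)) hlev hcl (X.core_le_closure_levels ha)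

/-! ### The trace on the core -/

/-- The average `|Λ^p|⁻¹ ∑ s_u⋆ a s_u` over the words `u` of degree `p`. -/
def average (p : Fin k → ℕ) : X.GraphAlg →ₗ[ℂ] X.GraphAlg where
  toFun a := (Fintype.card (X.Words p) : ℂ)⁻¹ • ∑ u : X.Words p, star (X.s u.1) * a * X.s u.1
  map_add' a b := by simp [mul_add, add_mul, Finset.sum_add_distrib]
  map_smul' c a := by simp [← Finset.smul_sum, smul_comm c]

lemma average_apply (p : Fin k → ℕ) (a : X.GraphAlg) : X.average p a =
    (Fintype.card (X.Words p) : ℂ)⁻¹ • ∑ u : X.Words p, star (X.s u.1) * a * X.s u.1 := rfl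

lemma card_words_pos (p : Fin k → ℕ) : 0 < Fintype.card (X.Words p) := by
  rw [X.card_words]
  exact Finset.prod_pos fun i _ => pow_pos (Nat.pos_of_ne_zero (X.numEdges_ne_zero i)) _

lemma card_words_ne_zero (p : Fin k → ℕ) : (Fintype.card (X.Words p) : ℂ) ≠ 0 := by
  exact_mod_cast (X.card_words_pos p).ne'

lemma norm_s_le (w : Λ) : ‖X.s w‖ ≤ 1 := by
  have h := CStarRing.norm_star_mul_self (x := X.s w)
  rw [X.star_s_mul_self w] at h
  have h1 : ‖(1 : X.GraphAlg)‖ ≤ 1 := by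
    have := CStarRing.norm_star_mul_self (x := (1 : X.GraphAlg))
    rw [star_one, one_mul] at this
    nlinarith [norm_nonneg (1 : X.GraphAlg)]
  nlinarith [norm_nonneg (X.s w)]

lemma norm_average_le (p : Fin k → ℕ) (a : X.GraphAlg) : ‖X.average p a‖ ≤ ‖a‖ := by
  rw [average_apply, norm_smul, norm_inv, Complex.norm_natCast,
    inv_mul_le_iff₀ (by exact_mod_cast X.card_words_pos p)]
  refine (norm_sum_le _ _).trans ?_
  rw [← nsmul_eq_mul, ← Finset.card_univ]
  refine Finset.sum_le_card_nsmul _ _ _ fun u _ => ?_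
  refine (norm_mul_le _ _).trans (mul_le_of_le_one_right (norm_nonneg _) (X.norm_s_le _) |>.trans ?_)
  refine (norm_mul_le _ _).trans ?_
  rw [norm_star]
  exact mul_le_of_le_one_left (norm_nonneg _) (X.norm_s_le _)

lemma average_add (p q : Fin k → ℕ) (a : X.GraphAlg) :
    X.average (p + q) a = X.average q (X.average p a) := by
  simp only [average_apply]
  rw [← (X.concat p q).sum_comp, ← Fintype.card_congr (X.concat p q), Fintype.card_prod,
    Fintype.sum_prod_type, Finset.sum_comm]
  simp only [concat_coe, map_mul, star_mul, mul_smul_comm, smul_mul_assoc, ← Finset.smul_sum,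
    Finset.mul_sum, Finset.sum_mul, smul_smul, mul_assoc, Nat.cast_mul, mul_inv, mul_comm]

lemma average_one (p : Fin k → ℕ) : X.average p 1 = 1 := by
  simp [average_apply, X.star_s_mul_self, ← Nat.cast_smul_eq_nsmul ℂ, smul_smul,
    inv_mul_cancel₀ (X.card_words_ne_zero p)]

/-- On level `p` the average is the normalised trace of the matrix, times `1`; averaging a scalar
further changes nothing. -/
lemma average_level {p : Fin k → ℕ} {b : X.GraphAlg} (hb : b ∈ X.level p) :
    ∃ c : ℂ, ∀ q, X.average (p + q) b = c • 1 := by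
  choose c hc using hb
  refine ⟨(Fintype.card (X.Words p) : ℂ)⁻¹ * ∑ u, c u u, fun q => ?_⟩
  rw [average_add, X.average_apply p]
  simp only [hc, ← Finset.sum_smul, smul_smul, map_smul, average_one]

lemma average_level_mul_comm {p : Fin k → ℕ} {a b : X.GraphAlg} (ha : a ∈ X.level p)
    (hb : b ∈ X.level p) : X.average p (a * b) = X.average p (b * a) := by
  choose c hc using ha
  choose d hd using hb
  simp only [average_apply, X.sum_compress p, hc, hd, smul_mul_smul_comm]
  rw [Finset.sum_comm]
  simp only [mul_comm]

/-- The averages over the words of degree `(n, …, n)`. -/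
def averageDiag (n : ℕ) : X.GraphAlg →ₗ[ℂ] X.GraphAlg := X.average fun _ => n

open Filter Topology

lemma eventually_averageDiag (p : Fin k → ℕ) :
    ∀ᶠ n in atTop, ∃ q, X.averageDiag n = X.average (p + q) := by
  filter_upwards [eventually_ge_atTop (∑ i, p i)] with n hn
  refine ⟨fun i => n - p i, ?_⟩
  rw [averageDiag]
  congr 1
  funext i
  have := Finset.single_le_sum (f := p) (fun _ _ => Nat.zero_le _) (Finset.mem_univ i)
  simp only [Pi.add_apply]
  omega

/-- The graph of the limit of the averages. -/
def averageGraph : AddSubgroup (X.GraphAlg × ℂ) where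
  carrier := {z | Tendsto (fun n => X.averageDiag n z.1) atTop (𝓝 (z.2 • 1))}
  zero_mem' := by simp
  add_mem' := fun {a b} ha hb => by
    simp only [Set.mem_ofPred_eq, Prod.fst_add, Prod.snd_add, map_add, add_smul] at *
    exact ha.add hb
  neg_mem' := fun {a} ha => by
    simp only [Set.mem_ofPred_eq, Prod.fst_neg, Prod.snd_neg, map_neg, neg_smul] at *
    exact ha.neg

variable {X} in
lemma mem_averageGraph {a : X.GraphAlg} {c : ℂ} : (a, c) ∈ X.averageGraph ↔
    Tendsto (fun n => X.averageDiag n a) atTop (𝓝 (c • 1)) := Iff.rfl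

/-- The averages are contractions, uniformly in `n`, so convergence to a scalar survives limits. -/
lemma isClosed_averageGraph : IsClosed (X.averageGraph : Set (X.GraphAlg × ℂ)) := by
  refine isClosed_of_closure_subset ?_
  rintro ⟨a, c⟩ hac
  refine Metric.tendsto_atTop.mpr fun ε hε => ?_
  -- Chosen so that the three errors `δ`, `δ` and `δ ‖1‖` add up to `ε`, whatever `‖1‖` is.
  have hδ : 0 < ε / (2 + ‖(1 : X.GraphAlg)‖) := by positivity
  set δ := ε / (2 + ‖(1 : X.GraphAlg)‖) with hδ'
  have hε' : ε = δ + δ + δ * ‖(1 : X.GraphAlg)‖ := by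
    rw [hδ']
    field_simp
    ring
  obtain ⟨⟨b, d⟩, hbd, hdist⟩ := Metric.mem_closure_iff.mp hac δ hδ
  obtain ⟨N, hN⟩ := Metric.tendsto_atTop.mp (mem_averageGraph.mp hbd) δ hδ
  refine ⟨N, fun n hn => ?_⟩
  have h1 : dist (X.averageDiag n a) (X.averageDiag n b) < δ := by
    rw [dist_eq_norm, ← map_sub]
    refine (X.norm_average_le _ _).trans_lt ?_
    rw [← dist_eq_norm]
    exact (le_max_left _ _).trans_lt hdist
  have h2 : dist (d • (1 : X.GraphAlg)) (c • 1) ≤ δ * ‖(1 : X.GraphAlg)‖ := by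
    rw [dist_eq_norm, ← sub_smul, norm_smul]
    refine mul_le_mul_of_nonneg_right ?_ (norm_nonneg _)
    rw [← dist_eq_norm, dist_comm]
    exact ((le_max_right _ _).trans_lt hdist).le
  have h3 := dist_triangle4 (X.averageDiag n a) (X.averageDiag n b) (d • (1 : X.GraphAlg)) (c • 1)
  have h4 := hN n hn
  simp only at h4 ⊢
  linarith

lemma norm_le_of_mem_averageGraph [Nontrivial X.GraphAlg] (z : X.GraphAlg × ℂ)
    (hz : z ∈ X.averageGraph) : ‖z.2‖ ≤ ‖z.1‖ := by
  have h := (mem_averageGraph.mp hz).norm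
  rw [norm_smul, norm_one, mul_one] at h
  exact le_of_tendsto h (Eventually.of_forall fun n => X.norm_average_le _ _)

/-- The elements whose averages converge to a scalar form a closed set, the scalar being bounded by
the norm. On the levels the averages are eventually constant. -/
lemma exists_mem_averageGraph [Nontrivial X.GraphAlg] {a : X.GraphAlg} (ha : a ∈ X.core) :
    ∃ c, (a, c) ∈ X.averageGraph := by
  have hcl := X.averageGraph.isClosed_image_fst X.isClosed_averageGraph
    X.norm_le_of_mem_averageGraph
  have hsub : (X.levels : Set X.GraphAlg) ⊆ Prod.fst '' (X.averageGraph : Set (X.GraphAlg × ℂ)) := by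
    rintro b ⟨p, hp⟩
    obtain ⟨c, hc⟩ := X.average_level hp
    refine ⟨(b, c), mem_averageGraph.mpr ?_, rfl⟩
    refine tendsto_const_nhds.congr' ?_
    filter_upwards [X.eventually_averageDiag p] with n ⟨q, hq⟩
    rw [hq, hc]
  obtain ⟨⟨b, c⟩, h, rfl⟩ := closure_minimal hsub hcl (X.core_le_closure_levels ha)
  exact ⟨c, h⟩

lemma averageGraph_unique [Nontrivial X.GraphAlg] {a : X.GraphAlg} {c d : ℂ}
    (hc : (a, c) ∈ X.averageGraph) (hd : (a, d) ∈ X.averageGraph) : c = d := by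
  have h := X.norm_le_of_mem_averageGraph _ (X.averageGraph.sub_mem hc hd)
  simpa [sub_eq_zero] using h

/-- In a common level the averages of a commutator are eventually zero, by the trace property of
matrices; density is then used in one variable at a time. -/
lemma commutator_mem_averageGraph {a b : X.GraphAlg} (ha : a ∈ X.core) (hb : b ∈ X.core) :
    (a * b - b * a, (0 : ℂ)) ∈ X.averageGraph := by
  have h1 : ∀ a ∈ X.levels, ∀ b ∈ X.levels, (a * b - b * a, (0 : ℂ)) ∈ X.averageGraph := by
    rintro a ⟨p, ha⟩ b ⟨q, hb⟩
    have ha := X.level_le_add_right p q ha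
    have hb := X.level_le_add_right q p hb
    rw [add_comm q p] at hb
    rw [mem_averageGraph, zero_smul]
    refine tendsto_const_nhds.congr' ?_
    filter_upwards [X.eventually_averageDiag (p + q)] with n ⟨r, hr⟩
    rw [hr, average_add, map_sub, X.average_level_mul_comm ha hb, sub_self, map_zero]
  have h2 : ∀ a ∈ X.levels.topologicalClosure, ∀ b ∈ X.levels,
      (a * b - b * a, (0 : ℂ)) ∈ X.averageGraph := fun a ha b hb =>
    closure_minimal (s := (X.levels : Set X.GraphAlg)) (fun a ha => h1 a ha b hb)
      (X.isClosed_averageGraph.preimage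
        (f := fun a : X.GraphAlg => (a * b - b * a, (0 : ℂ))) (by fun_prop)) ha
  exact closure_minimal (s := (X.levels : Set X.GraphAlg))
    (fun b hb => h2 a (X.core_le_closure_levels ha) b hb)
    (X.isClosed_averageGraph.preimage
      (f := fun b : X.GraphAlg => (a * b - b * a, (0 : ℂ))) (by fun_prop))
    (X.core_le_closure_levels hb)

lemma average_star_mul_self_nonneg (p : Fin k → ℕ) (a : X.GraphAlg) :
    0 ≤ X.average p (star a * a) := by
  rw [average_apply]
  refine smul_nonneg (by positivity) (Finset.sum_nonneg fun u _ => ?_)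
  have : star (X.s u.1) * (star a * a) * X.s u.1 = star (a * X.s u.1) * (a * X.s u.1) := by
    simp only [star_mul, mul_assoc]
  rw [this]
  exact star_mul_self_nonneg _

lemma nonneg_of_smul_one_nonneg [Nontrivial X.GraphAlg] {c : ℂ} (h : 0 ≤ c • (1 : X.GraphAlg)) :
    0 ≤ c := by
  refine spectrum_nonneg_of_nonneg h ?_
  rw [← Algebra.algebraMap_eq_smul_one, spectrum.scalar_eq]
  exact Set.mem_singleton c

/-- The state is the limit of the averages. Without existence, `trace` would be its default value
`0`. -/
lemma exists_isTracialState [Nontrivial X.GraphAlg] : ∃ τ : X.core →ₗ[ℂ] ℂ, X.IsTracialState τ := by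
  have hex : ∀ a ∈ X.core, ∃ c, (a, c) ∈ X.averageGraph := fun a ha => X.exists_mem_averageGraph ha
  choose! c hc using hex
  have hadd : ∀ a ∈ X.core, ∀ b ∈ X.core, c (a + b) = c a + c b := fun a ha b hb => by
    have h := X.averageGraph.add_mem (hc a ha) (hc b hb)
    rw [Prod.mk_add_mk] at h
    exact X.averageGraph_unique (hc _ (add_mem ha hb)) h
  have hsmul : ∀ (z : ℂ), ∀ a ∈ X.core, c (z • a) = z * c a := fun z a ha => by
    refine X.averageGraph_unique (hc _ (SMulMemClass.smul_mem z ha)) (mem_averageGraph.mpr ?_)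
    have h := (mem_averageGraph.mp (hc a ha)).const_smul z
    simpa only [← map_smul, smul_smul] using h
  let τ : X.core →ₗ[ℂ] ℂ :=
    { toFun := fun a => c a.1
      map_add' := fun a b => hadd a.1 a.2 b.1 b.2
      map_smul' := fun z a => hsmul z a.1 a.2 }
  refine ⟨τ, ?_, fun a => ?_, fun a b => ?_⟩
  · refine X.averageGraph_unique (hc 1 (one_mem _)) (mem_averageGraph.mpr ?_)
    simp [averageDiag, average_one]
  · have h0 := mem_averageGraph.mp (hc _ (mul_mem (star_mem a.2) a.2))
    have h1 : 0 ≤ c (star a.1 * a.1) := X.nonneg_of_smul_one_nonneg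
      (CStarAlgebra.isClosed_nonneg.mem_of_tendsto h0
        (Eventually.of_forall fun n => X.average_star_mul_self_nonneg _ _))
    obtain ⟨x, hx, hxc⟩ := RCLike.nonneg_iff_exists_ofReal.mp h1
    exact ⟨x, hx, hxc.symm⟩
  · have h := X.averageGraph.add_mem (X.commutator_mem_averageGraph a.2 b.2)
      (hc _ (mul_mem b.2 a.2))
    rw [Prod.mk_add_mk, sub_add_cancel, zero_add] at h
    exact X.averageGraph_unique (hc _ (mul_mem a.2 b.2)) h

lemma isTracialState_trace [Nontrivial X.GraphAlg] : X.IsTracialState X.trace := by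
  rw [trace, dif_pos X.exists_isTracialState]
  exact X.exists_isTracialState.choose_spec

end SingleVertexKGraph

namespace SingleVertexKGraph

variable {k : ℕ} {Λ : Type*} [Monoid Λ] (X : SingleVertexKGraph k Λ)

/-! ### The state `ω` and its KMS property -/

lemma omega_apply (a : X.GraphAlg) : X.omega a = X.trace (X.expectation a) := rfl

lemma continuous_omega : Continuous X.omega := map_continuous X.omega

lemma expectation_of_mem_core {a : X.GraphAlg} (ha : a ∈ X.core) : X.expectation a = ⟨a, ha⟩ :=
  Subtype.ext ((X.mem_core_iff).mp ha).Phi_self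

lemma Phi_zero_core_mul {c : X.GraphAlg} (hc : c ∈ X.core) (b : X.GraphAlg) :
    X.Phi 0 (c * b) = c * X.Phi 0 b := by
  simp only [Phi_zero_apply, map_mul, hc _]
  exact integral_const_mul_of_integrable (X.integrable_gauge b)

lemma Phi_zero_mul_core {c : X.GraphAlg} (hc : c ∈ X.core) (b : X.GraphAlg) :
    X.Phi 0 (b * c) = X.Phi 0 b * c := by
  simp only [Phi_zero_apply, map_mul, hc _]
  exact integral_mul_const_of_integrable (X.integrable_gauge b)

lemma omega_gauge (t : UnitAddTorus (Fin k)) (a : X.GraphAlg) : X.omega (X.gauge t a) = X.omega a := by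
  rw [omega_apply, omega_apply]
  congr 1
  refine Subtype.ext ?_
  change X.Phi 0 _ = X.Phi 0 a
  rw [Phi_gauge, mFourier_zero, ContinuousMap.one_apply, one_smul]

lemma omega_of_isHomog {a : X.GraphAlg} {n : Fin k → ℤ} (ha : X.IsHomog a n) (hn : n ≠ 0) :
    X.omega a = 0 := by
  rw [omega_apply]
  have : X.expectation a = 0 := Subtype.ext (ha.Phi_of_ne hn.symm)
  rw [this, map_zero]

lemma mono_mem_core {u v : Λ} (h : X.deg u = X.deg v) : X.mono u v ∈ X.core := by
  have h1 := X.isHomog_mono u v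
  have h2 : X.zdeg u = X.zdeg v := by
    funext i
    simp [zdeg, h]
  rw [h2, sub_self] at h1
  exact (X.mem_core_iff).mpr h1

lemma mono_mul_mono_self (u v w : Λ) : X.mono u v * X.mono v w = X.mono u w := by
  rw [mono, mono, mono, mul_assoc, ← mul_assoc (star (X.s v)), X.star_s_mul_self, one_mul]

/-- The number of words of the same degree as `w`. -/
def weight (w : Λ) : ℝ := Fintype.card (X.Words (X.deg w))

lemma weight_pos (w : Λ) : 0 < X.weight w := by
  rw [weight]
  exact_mod_cast X.card_words_pos _

lemma weight_mul (u v : Λ) : X.weight (u * v) = X.weight u * X.weight v := by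
  rw [weight, X.deg_mul, ← Fintype.card_congr (X.concat _ _), Fintype.card_prod, Nat.cast_mul]
  rfl

section

variable [Nontrivial X.GraphAlg]

lemma omega_one : X.omega 1 = 1 := by
  rw [omega_apply, X.expectation_of_mem_core (one_mem _)]
  exact X.isTracialState_trace.map_one

/-- The core is contained in the centralizer of `ω`. -/
lemma omega_core_mul_comm {c : X.GraphAlg} (hc : c ∈ X.core) (b : X.GraphAlg) :
    X.omega (c * b) = X.omega (b * c) := by
  have h1 : X.expectation (c * b) = ⟨c, hc⟩ * X.expectation b :=
    Subtype.ext (X.Phi_zero_core_mul hc b)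
  have h2 : X.expectation (b * c) = X.expectation b * ⟨c, hc⟩ :=
    Subtype.ext (X.Phi_zero_mul_core hc b)
  rw [omega_apply, omega_apply, h1, h2]
  exact X.isTracialState_trace.tracial _ _

/-- For equal degrees write `s_u s_v⋆ = (s_u s_u⋆)(s_u s_v⋆)` and move the first factor, which is in
the core, to the right, where `s_v⋆ s_u = 0`. For unequal degrees `Φ_0` vanishes. -/
lemma omega_mono_of_ne {u v : Λ} (h : u ≠ v) : X.omega (X.mono u v) = 0 := by
  by_cases hd : X.deg u = X.deg v
  · have hz : star (X.s v) * X.s u = 0 :=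
      X.star_s_mul_of_ne _ ⟨v, rfl⟩ ⟨u, hd⟩ fun h' => h (congrArg Subtype.val h').symm
    rw [← X.mono_mul_mono_self u u v, X.omega_core_mul_comm (X.mono_mem_core rfl), mono, mono,
      mul_assoc, ← mul_assoc (star (X.s v)), hz]
    simp
  · exact X.omega_of_isHomog (X.isHomog_mono u v)
      (sub_ne_zero.mpr fun h' => hd (X.zdeg_injective h'))

/-- The projections `s_v s_v⋆` with `d(v) = d(u)` are equivalent in the core through `s_v s_u⋆`, so
they have equal trace, and they sum to `1`. -/
lemma omega_mono_self (u : Λ) : X.omega (X.mono u u) = (X.weight u : ℂ)⁻¹ := by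
  have h1 : ∀ v : X.Words (X.deg u), X.omega (X.mono v.1 v.1) = X.omega (X.mono u u) := fun v => by
    rw [← X.mono_mul_mono_self v.1 u v.1, X.omega_core_mul_comm (X.mono_mem_core v.2),
      X.mono_mul_mono_self]
  have h2 : ∑ v : X.Words (X.deg u), X.omega (X.mono v.1 v.1) = 1 := by
    rw [← map_sum]
    exact (congrArg X.omega (X.sum_s_mul_star (X.deg u))).trans X.omega_one
  simp only [h1, Finset.sum_const, nsmul_eq_mul, Finset.card_univ] at h2
  refine eq_inv_of_mul_eq_one_right ?_
  rw [weight, Complex.ofReal_natCast]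
  exact h2

lemma omega_s_mul_mul_star (w : Λ) (b : X.GraphAlg) :
    X.omega (X.s w * b * star (X.s w)) = (X.weight w : ℂ)⁻¹ * X.omega b := by
  let f : X.GraphAlg →ₗ[ℂ] ℂ := X.omega.toLinearMap ∘ₗ
    (LinearMap.mulRight ℂ (star (X.s w)) ∘ₗ LinearMap.mulLeft ℂ (X.s w))
  let g : X.GraphAlg →ₗ[ℂ] ℂ := (X.weight w : ℂ)⁻¹ • X.omega.toLinearMap
  have hω := X.continuous_omega
  have hf : Continuous f :=
    hω.comp (show Continuous fun b => X.s w * b * star (X.s w) by fun_prop)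
  have hg : Continuous g := continuous_const.mul hω
  refine X.eq_of_eq_on_mono hf hg (fun u v => ?_) b
  change X.omega (X.s w * X.mono u v * star (X.s w)) = (X.weight w : ℂ)⁻¹ * X.omega (X.mono u v)
  have h : X.s w * X.mono u v * star (X.s w) = X.mono (w * u) (w * v) := by
    simp only [mono, map_mul, star_mul, mul_assoc]
  rw [h]
  by_cases huv : u = v
  · rw [huv, omega_mono_self, omega_mono_self, weight_mul, Complex.ofReal_mul, mul_inv]
  · have : w * u ≠ w * v := by
      intro h'
      by_cases hd : X.deg u = X.deg v
      · have h1 := (X.concat (X.deg w) (X.deg v)).injective (a₁ := (⟨w, rfl⟩, ⟨u, hd⟩))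
          (a₂ := (⟨w, rfl⟩, ⟨v, rfl⟩)) (Subtype.ext h')
        exact huv (congrArg (fun x => x.2.1) h1)
      · have h1 := congrArg X.deg h'
        rw [X.deg_mul, X.deg_mul] at h1
        exact hd (add_left_cancel h1)
    rw [X.omega_mono_of_ne this, X.omega_mono_of_ne huv, mul_zero]

/-- Write `s_w = (s_w s_w⋆) s_w` and move the core projection to the far right; this leaves `s_w (b
s_w) s_w⋆`, which `ω` scales by `|w|⁻¹`. -/
lemma omega_s_mul (w : Λ) (b : X.GraphAlg) :
    X.omega (X.s w * b) = (X.weight w : ℂ)⁻¹ * X.omega (b * X.s w) := by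
  calc X.omega (X.s w * b) = X.omega (X.mono w w * (X.s w * b)) := by
        rw [mono, mul_assoc, ← mul_assoc (star (X.s w)), X.star_s_mul_self, one_mul]
    _ = X.omega (X.s w * (b * X.s w) * star (X.s w)) := by
        rw [X.omega_core_mul_comm (X.mono_mem_core rfl)]
        simp only [mono, mul_assoc]
    _ = _ := X.omega_s_mul_mul_star w _

lemma omega_mul_star_s (w : Λ) (b : X.GraphAlg) :
    X.omega (b * star (X.s w)) = (X.weight w : ℂ)⁻¹ * X.omega (star (X.s w) * b) := by
  have h := congrArg star (X.omega_s_mul w (star b))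
  rw [← map_star X.omega, star_mul', ← map_star X.omega] at h
  simpa using h

/-- The KMS property of `ω`, for `s_u s_v⋆`. -/
lemma omega_mono_mul (u v : Λ) (b : X.GraphAlg) :
    X.omega (X.mono u v * b) = ((X.weight v / X.weight u : ℝ) : ℂ) * X.omega (b * X.mono u v) := by
  have h1 : (X.weight v : ℂ) ≠ 0 := by exact_mod_cast (X.weight_pos v).ne'
  have h2 := X.omega_mul_star_s v (b * X.s u)
  rw [mono, mul_assoc, X.omega_s_mul, ← mul_assoc b, h2, mul_assoc (star (X.s v))]
  push_cast
  field_simp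

end

end SingleVertexKGraph

/-- The continuous functional calculus of an operator acts on an eigenvector of the operator. -/
lemma ContinuousLinearMap.cfc_apply_eigenvector {H : Type*} [NormedAddCommGroup H]
    [InnerProductSpace ℂ H] [CompleteSpace H] {T : H →L[ℂ] H} (hT : IsSelfAdjoint T) {ξ : H} {c : ℝ}
    (h : T ξ = (c : ℂ) • ξ) {g : ℂ → ℂ} (hg : ContinuousOn g (spectrum ℂ T)) :
    cfc g T ξ = g c • ξ := by
  by_cases hξ : ξ = 0
  · simp [hξ]
  have hn : IsStarNormal T := hT.isStarNormal
  -- Membership is needed for evaluation at `c` to make sense on `C(spectrum ℂ T, ℂ)`.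
  have hc : (c : ℂ) ∈ spectrum ℂ T := by
    rw [spectrum.mem_iff]
    rintro ⟨u, hu⟩
    have h1 : (u : H →L[ℂ] H) ξ = 0 := by
      rw [hu]
      simp [Algebra.algebraMap_eq_smul_one, h]
    have h2 : ((u⁻¹ : (H →L[ℂ] H)ˣ) * u : H →L[ℂ] H) ξ = ξ := by simp
    rw [mul_apply_eq_comp, h1, map_zero] at h2
    exact hξ h2.symm
  rw [cfc_apply g T hn hg]
  -- Stone–Weierstrass: the identity is closed under sums, products and limits, and holds for `z`
  -- and, `T` being self-adjoint and `c` real, for its conjugate.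
  have key : ∀ φ : C(spectrum ℂ T, ℂ), cfcHom hn φ ξ = φ ⟨c, hc⟩ • ξ := by
    intro φ
    induction φ using ContinuousMap.induction_on_of_compact with
    | const r =>
      have : ContinuousMap.const (spectrum ℂ T) r = algebraMap ℂ C(spectrum ℂ T, ℂ) r := rfl
      rw [this, AlgHomClass.commutes]
      simp [Algebra.algebraMap_eq_smul_one]
    | id => rw [cfcHom_id hn, h]; rfl
    | star_id =>
      rw [map_star, cfcHom_id hn, hT.star_eq, h]
      simp
    | add φ ψ h1 h2 => simp [map_add, h1, h2, add_smul]
    | mul φ ψ h1 h2 =>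
      rw [map_mul, mul_apply_eq_comp, h2, map_smul, h1, smul_smul, mul_comm]
      rfl
    | frequently φ hφ =>
      have hcl : IsClosed {φ : C(spectrum ℂ T, ℂ) | cfcHom hn φ ξ = φ ⟨c, hc⟩ • ξ} := by
        have := cfcHom_continuous hn (R := ℂ)
        refine isClosed_eq (by fun_prop) (by fun_prop)
      exact hcl.mem_of_frequently_of_tendsto hφ Filter.tendsto_id
  exact key _

namespace Modular

variable {A : Type*} [CStarAlgebra A] [PartialOrder A] [StarOrderedRing A] (f : A →ₚ[ℂ] ℂ)

/-! ### The GNS space -/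

lemma vec_add (a b : A) : vec f (a + b) = vec f a + vec f b := by
  simp only [vec, map_add, UniformSpace.Completion.coe_add]

lemma vec_smul (c : ℂ) (a : A) : vec f (c • a) = c • vec f a := by
  simp only [vec, map_smul, UniformSpace.Completion.coe_smul]

/-- `vec` as a linear map. -/
def vecL : A →ₗ[ℂ] f.GNS where
  toFun := vec f
  map_add' := vec_add f
  map_smul' := vec_smul f

lemma inner_vec (a b : A) : ⟪vec f a, vec f b⟫_ℂ = f (star a * b) := by
  simp only [vec, UniformSpace.Completion.inner_coe, PositiveLinearMap.preGNS_inner_def,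
    PositiveLinearMap.ofPreGNS_toPreGNS]

lemma gns_vec (a b : A) : f.gnsStarAlgHom a (vec f b) = vec f (a * b) := by
  simp only [vec, PositiveLinearMap.gnsStarAlgHom_apply]
  exact (f.gnsNonUnitalStarAlgHom_apply_coe).trans rfl

lemma continuous_vec : Continuous (vec f) := by
  have h : ∀ a, vec f a = f.gnsStarAlgHom a (vec f 1) := fun a => by rw [gns_vec, mul_one]
  have h2 : Continuous fun a => f.gnsStarAlgHom a (vec f 1) :=
    (ContinuousLinearMap.apply ℂ f.GNS (vec f 1)).continuous.comp
      (f.gnsStarAlgHom.continuous_of_cstar)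
  exact h2.congr fun a => (h a).symm

lemma denseRange_vec : DenseRange (vec f) :=
  (UniformSpace.Completion.denseRange_coe (α := f.PreGNS)).comp
    f.toPreGNS.surjective.denseRange (UniformSpace.Completion.continuous_coe _)

/-! ### Eigenvectors of the modular operator -/

/-- `a` satisfies the KMS relation which makes `π(a)Ω` an eigenvector of the modular operator with
eigenvalue `l`. -/
def IsEigen (a : A) (l : ℝ) : Prop :=
  0 < l ∧ ∀ b, f (b * star a) = (l : ℂ) * f (star a * b)

/-- A family of elements as in `IsEigen`, which spans a dense subspace. -/
def IsEigenFamily {ι : Type*} (e : ι → A) (l : ι → ℝ) : Prop :=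
  (∀ i, IsEigen f (e i) (l i)) ∧ (Submodule.span ℂ (Set.range e)).topologicalClosure = ⊤

variable {f} {ι : Type*} {e : ι → A} {l : ι → ℝ}

lemma IsEigenFamily.eq_top (hd : IsEigenFamily f e l) {N : Submodule ℂ f.GNS}
    (hN : IsClosed (N : Set f.GNS)) (h : ∀ i, vec f (e i) ∈ N) : N = ⊤ := by
  have hle : Submodule.span ℂ (Set.range e) ≤ N.comap (vecL f) := by
    rw [Submodule.span_le]
    rintro _ ⟨i, rfl⟩
    exact h i
  have h1 := Submodule.topologicalClosure_minimal _ hle (hN.preimage (continuous_vec f))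
  rw [hd.2] at h1
  rw [eq_top_iff]
  rintro ξ -
  exact closure_minimal (s := Set.range (vec f))
    (by rintro _ ⟨a, rfl⟩; exact h1 (Submodule.mem_top (x := a))) hN (denseRange_vec f ξ)

lemma IsEigenFamily.clm_ext (hd : IsEigenFamily f e l) {V W : f.GNS →L[ℂ] f.GNS}
    (h : ∀ i, V (vec f (e i)) = W (vec f (e i))) : V = W := by
  have hN := hd.eq_top (N := LinearMap.eqLocus V.toLinearMap W.toLinearMap)
    (isClosed_eq V.continuous W.continuous) h
  ext ξ
  have : ξ ∈ LinearMap.eqLocus V.toLinearMap W.toLinearMap := hN ▸ Submodule.mem_top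
  exact this

variable (f)

/-- The graph of the Tomita operator as a subgroup. -/
def tomitaSubgroup : AddSubgroup (f.GNS × f.GNS) :=
  (AddMonoidHom.range (AddMonoidHom.mk' (fun a : A => (vec f a, vec f (star a))) fun a b => by
    simp [vec_add])).topologicalClosure

variable {f}

lemma isClosed_tomitaGraph : IsClosed (tomitaGraph f) := isClosed_closure

lemma vec_mem_tomitaGraph (a : A) : (vec f a, vec f (star a)) ∈ tomitaGraph f :=
  subset_closure ⟨a, rfl⟩

lemma smul_mem_tomitaGraph (c : ℂ) {x : f.GNS × f.GNS} (hx : x ∈ tomitaGraph f) :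
    (c • x.1, star c • x.2) ∈ tomitaGraph f := by
  let φ : f.GNS × f.GNS → f.GNS × f.GNS := fun x => (c • x.1, star c • x.2)
  have hsmul : ∀ d : ℂ, Continuous fun ξ : f.GNS => d • ξ := fun d =>
    (d • ContinuousLinearMap.id ℂ f.GNS).continuous
  have hφ : Continuous φ :=
    ((hsmul c).comp continuous_fst).prodMk ((hsmul (star c)).comp continuous_snd)
  have hvec : ∀ a, φ (vec f a, vec f (star a)) = (vec f (c • a), vec f (star (c • a))) := fun a => by
    rw [star_smul, vec_smul, vec_smul]
  have hsub : Set.range (fun a : A => (vec f a, vec f (star a))) ⊆ φ ⁻¹' tomitaGraph f := by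
    rw [Set.range_subset_iff]
    intro a
    rw [Set.mem_preimage, hvec]
    exact vec_mem_tomitaGraph (c • a)
  exact closure_minimal hsub (isClosed_tomitaGraph.preimage hφ) hx

lemma isClosed_tomitaAdjointGraph : IsClosed (tomitaAdjointGraph f) := by
  have : tomitaAdjointGraph f = ⋂ x ∈ tomitaGraph f,
      {y : f.GNS × f.GNS | ⟪x.2, y.1⟫_ℂ = ⟪y.2, x.1⟫_ℂ} := by
    ext y
    simp [tomitaAdjointGraph]
  rw [this]
  exact isClosed_biInter fun x _ => isClosed_eq (by fun_prop) (by fun_prop)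

lemma mem_tomitaAdjointGraph_of_vec {y : f.GNS × f.GNS}
    (h : ∀ b : A, ⟪vec f (star b), y.1⟫_ℂ = ⟪y.2, vec f b⟫_ℂ) : y ∈ tomitaAdjointGraph f := by
  intro x hx
  refine closure_minimal (t := {x : f.GNS × f.GNS | ⟪x.2, y.1⟫_ℂ = ⟪y.2, x.1⟫_ℂ}) ?_
    (isClosed_eq (by fun_prop) (by fun_prop)) hx
  rintro _ ⟨b, rfl⟩
  exact h b

/-! ### The resolvent of the modular operator. -/

variable (f)

/-- The triples `(ξ, η, η')` with `η' = S η` and `ξ - η = S⋆ η'`, that is `ξ = (1 + S⋆ S) η`. -/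
def resolventGraph : AddSubgroup (f.GNS × (f.GNS × f.GNS)) where
  carrier := {z | z.2 ∈ tomitaGraph f ∧ (z.2.2, z.1 - z.2.1) ∈ tomitaAdjointGraph f}
  zero_mem' := ⟨(tomitaSubgroup f).zero_mem, fun x _ => by simp⟩
  add_mem' := fun {z w} hz hw => ⟨(tomitaSubgroup f).add_mem hz.1 hw.1, fun x hx => by
    have h1 := hz.2 x hx
    have h2 := hw.2 x hx
    simp only [Prod.snd_add, Prod.fst_add, inner_add_right] at h1 h2 ⊢
    rw [h1, h2, ← inner_add_left]
    congr 1
    abel⟩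
  neg_mem' := fun {z} hz => ⟨(tomitaSubgroup f).neg_mem hz.1, fun x hx => by
    have h1 := hz.2 x hx
    simp only [Prod.snd_neg, Prod.fst_neg, inner_neg_right] at h1 ⊢
    rw [h1, ← inner_neg_left]
    congr 1
    abel⟩

variable {f}

lemma mem_resolventGraph {ξ η η' : f.GNS} : (ξ, (η, η')) ∈ resolventGraph f ↔
    (η, η') ∈ tomitaGraph f ∧ (η', ξ - η) ∈ tomitaAdjointGraph f := Iff.rfl

lemma isClosed_resolventGraph : IsClosed (resolventGraph f : Set (f.GNS × (f.GNS × f.GNS))) :=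
  (isClosed_tomitaGraph.preimage continuous_snd).inter
    (isClosed_tomitaAdjointGraph.preimage
      (f := fun z : f.GNS × (f.GNS × f.GNS) => (z.2.2, z.1 - z.2.1)) (by fun_prop))

lemma smul_mem_resolventGraph (c : ℂ) {ξ η η' : f.GNS} (h : (ξ, (η, η')) ∈ resolventGraph f) :
    (c • ξ, (c • η, star c • η')) ∈ resolventGraph f := by
  refine ⟨smul_mem_tomitaGraph c h.1, fun x hx => ?_⟩
  have := h.2 x hx
  simp only at this ⊢
  rw [inner_smul_right, this, ← smul_sub, inner_smul_left]
  rfl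

/-- Testing the adjoint relation against the pair `(η, η')` itself gives `‖η'‖² = ⟪ξ - η, η⟫`.
Boundedness, uniqueness and positivity of the resolvent all come from this identity. -/
lemma inner_of_mem_resolventGraph {ξ η η' : f.GNS} (h : (ξ, (η, η')) ∈ resolventGraph f) :
    ⟪ξ, η⟫_ℂ = ((‖η‖ ^ 2 + ‖η'‖ ^ 2 : ℝ) : ℂ) := by
  have h1 : ⟪η', η'⟫_ℂ = ⟪ξ - η, η⟫_ℂ := h.2 (η, η') h.1
  rw [inner_sub_left, inner_self_eq_norm_sq_to_K, inner_self_eq_norm_sq_to_K] at h1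
  push_cast
  have h1 : (‖η'‖ : ℂ) ^ 2 = ⟪ξ, η⟫_ℂ - (‖η‖ : ℂ) ^ 2 := h1
  rw [h1]
  ring

lemma norm_le_of_mem_resolventGraph (z : f.GNS × (f.GNS × f.GNS)) (h : z ∈ resolventGraph f) :
    ‖z.2‖ ≤ ‖z.1‖ := by
  obtain ⟨ξ, η, η'⟩ := z
  have h1 := congrArg norm (inner_of_mem_resolventGraph h)
  rw [Complex.norm_real, Real.norm_of_nonneg (by positivity)] at h1
  have h2 := norm_inner_le_norm (𝕜 := ℂ) ξ η
  have h3 : ‖η‖ ≤ ‖ξ‖ := by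
    by_contra! hlt
    nlinarith [norm_nonneg ξ, norm_nonneg η, sq_nonneg ‖η'‖]
  have h4 : ‖η'‖ ≤ ‖ξ‖ := by
    refine abs_le_of_sq_le_sq' ?_ (norm_nonneg _) |>.2
    nlinarith [norm_nonneg ξ, norm_nonneg η, sq_nonneg (‖ξ‖ - ‖η‖)]
  exact max_le h3 h4

/-- For `η = (1 + l)⁻¹ π(a)Ω` one has `ξ - η = l η`, and the adjoint relation tested on `π(b)Ω` is
then exactly the KMS relation in `IsEigen`. -/
lemma IsEigen.mem_resolventGraph {a : A} {l : ℝ} (h : IsEigen f a l) :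
    (vec f a, (((1 + l)⁻¹ : ℝ) : ℂ) • vec f a, (((1 + l)⁻¹ : ℝ) : ℂ) • vec f (star a)) ∈
      resolventGraph f := by
  have hl : (1 + l : ℂ) ≠ 0 := by exact_mod_cast (by linarith [h.1] : (1 + l : ℝ) ≠ 0)
  constructor
  · have := smul_mem_tomitaGraph (((1 + l)⁻¹ : ℝ) : ℂ) (vec_mem_tomitaGraph (f := f) a)
    simpa using this
  · refine mem_tomitaAdjointGraph_of_vec fun b => ?_
    have h1 : vec f a - (((1 + l)⁻¹ : ℝ) : ℂ) • vec f a =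
        ((l * (1 + l)⁻¹ : ℝ) : ℂ) • vec f a := by
      nth_rewrite 1 [← one_smul ℂ (vec f a)]
      rw [← sub_smul]
      congr 1
      push_cast
      field_simp
      ring
    simp only
    rw [h1, inner_smul_right, inner_smul_left, inner_vec, inner_vec, star_star, h.2 b,
      Complex.conj_ofReal]
    push_cast
    ring

/-- The range of `1 + S⋆ S` is closed by the norm bound and contains the eigenvectors, which span a
dense subspace. -/
lemma exists_mem_resolventGraph (hd : IsEigenFamily f e l) (ξ : f.GNS) : ∃ z, (ξ, z) ∈ resolventGraph f := by
  have hcl := (resolventGraph f).isClosed_image_fst isClosed_resolventGraph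
    norm_le_of_mem_resolventGraph
  let N : Submodule ℂ f.GNS :=
    { carrier := Prod.fst '' (resolventGraph f : Set (f.GNS × (f.GNS × f.GNS)))
      zero_mem' := ⟨0, (resolventGraph f).zero_mem, rfl⟩
      add_mem' := by
        rintro _ _ ⟨z, hz, rfl⟩ ⟨w, hw, rfl⟩
        exact ⟨z + w, (resolventGraph f).add_mem hz hw, rfl⟩
      smul_mem' := by
        rintro c _ ⟨z, hz, rfl⟩
        exact ⟨_, smul_mem_resolventGraph c hz, rfl⟩ }
  have hN : N = ⊤ := hd.eq_top hcl fun i => ⟨_, (hd.1 i).mem_resolventGraph, rfl⟩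
  have hξ : ξ ∈ N := hN ▸ Submodule.mem_top
  obtain ⟨z, hz, rfl⟩ := hξ
  exact ⟨z.2, hz⟩

lemma resolventGraph_unique {ξ : f.GNS} {z w : f.GNS × f.GNS} (hz : (ξ, z) ∈ resolventGraph f)
    (hw : (ξ, w) ∈ resolventGraph f) : z = w := by
  have h := norm_le_of_mem_resolventGraph _ ((resolventGraph f).sub_mem hz hw)
  simpa [sub_eq_zero] using h

/-- `resolvent` is a choice, so its defining property holds once one operator has it: the one whose
graph is read off from `resolventGraph`. -/
lemma resolvent_spec (hd : IsEigenFamily f e l) (ξ η : f.GNS) :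
    resolvent f ξ = η ↔ (η, ξ - η) ∈ modularGraph f := by
  refine Classical.epsilon_spec
    (p := fun T : f.GNS →L[ℂ] f.GNS => ∀ ξ η, T ξ = η ↔ (η, ξ - η) ∈ modularGraph f) ?_ ξ η
  choose z hz using exists_mem_resolventGraph hd
  have hadd : ∀ ξ ξ', z (ξ + ξ') = z ξ + z ξ' := fun ξ ξ' => by
    have h := (resolventGraph f).add_mem (hz ξ) (hz ξ')
    rw [Prod.mk_add_mk] at h
    exact resolventGraph_unique (hz _) h
  have hsmul : ∀ (c : ℂ) ξ, (z (c • ξ)).1 = c • (z ξ).1 := fun c ξ =>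
    congrArg Prod.fst (resolventGraph_unique (hz _) (smul_mem_resolventGraph c (hz ξ)))
  let T : f.GNS →ₗ[ℂ] f.GNS :=
    { toFun := fun ξ => (z ξ).1
      map_add' := fun ξ ξ' => by rw [hadd, Prod.fst_add]
      map_smul' := hsmul }
  refine ⟨T.mkContinuous 1 fun ξ => ?_, fun ξ η => ⟨?_, ?_⟩⟩
  · rw [one_mul]
    exact (le_max_left _ _).trans (norm_le_of_mem_resolventGraph _ (hz ξ))
  · rintro rfl
    exact ⟨(z ξ).2, (hz ξ).1, (hz ξ).2⟩
  · rintro ⟨η', h1, h2⟩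
    have h : (ξ, (η, η')) ∈ resolventGraph f := ⟨h1, h2⟩
    exact congrArg Prod.fst (resolventGraph_unique (hz ξ) h)

lemma resolvent_mem (hd : IsEigenFamily f e l) (ξ : f.GNS) :
    ∃ η', (ξ, (resolvent f ξ, η')) ∈ resolventGraph f := by
  obtain ⟨η', h1, h2⟩ := (resolvent_spec hd ξ _).mp rfl
  exact ⟨η', h1, h2⟩

lemma IsEigen.resolvent_vec (hd : IsEigenFamily f e l) {a : A} {m : ℝ} (h : IsEigen f a m) :
    resolvent f (vec f a) = (((1 + m)⁻¹ : ℝ) : ℂ) • vec f a :=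
  (resolvent_spec hd _ _).mpr ⟨_, h.mem_resolventGraph.1, h.mem_resolventGraph.2⟩

lemma isPositive_resolvent (hd : IsEigenFamily f e l) : (resolvent f).IsPositive := by
  rw [ContinuousLinearMap.isPositive_iff_complex]
  intro ξ
  obtain ⟨η', h⟩ := resolvent_mem hd ξ
  have h1 := inner_of_mem_resolventGraph h
  have h2 : ⟪resolvent f ξ, ξ⟫_ℂ = ((‖resolvent f ξ‖ ^ 2 + ‖η'‖ ^ 2 : ℝ) : ℂ) := by
    rw [← inner_conj_symm, h1, Complex.conj_ofReal]
  rw [h2]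
  exact ⟨rfl, by simp only [RCLike.re_to_complex, Complex.ofReal_re]; positivity⟩

/-! ### The unitaries `Δ^{it}`. -/

lemma norm_powerSymbol (t x : ℝ) : ‖powerSymbol t x‖ = |x * (1 - x)| := by
  rw [powerSymbol, norm_mul, Complex.norm_real, Real.norm_eq_abs]
  have : Complex.I * t * Real.log ((1 - x) / x) = ((t * Real.log ((1 - x) / x) : ℝ) : ℂ) * Complex.I := by
    push_cast
    ring
  rw [this, Complex.norm_exp_ofReal_mul_I, mul_one]

/-- The modulus `|x (1 - x)|` tends to `0` at `0` and `1`, so the conventional values of the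
quotient and logarithm there do no harm. Elsewhere `Real.log` is continuous, also at negative
arguments. -/
lemma continuous_powerSymbol (t : ℝ) : Continuous (powerSymbol t) := by
  rw [continuous_iff_continuousAt]
  intro x
  by_cases hx : x * (1 - x) = 0
  · have h0 : powerSymbol t x = 0 := by
      rw [← norm_eq_zero, norm_powerSymbol, hx, abs_zero]
    rw [ContinuousAt, h0]
    refine squeeze_zero_norm (fun y => (norm_powerSymbol t y).le) ?_
    have : Continuous fun y : ℝ => |y * (1 - y)| := by fun_prop
    simpa [hx] using this.tendsto x
  · have h1 : x ≠ 0 := left_ne_zero_of_mul hx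
    have h2 : 1 - x ≠ 0 := right_ne_zero_of_mul hx
    have h3 : ContinuousAt (fun x : ℝ => Real.log ((1 - x) / x)) x :=
      ContinuousAt.log (ContinuousAt.div (by fun_prop) (by fun_prop) h1) (div_ne_zero h2 h1)
    have h4 : ContinuousAt (fun x : ℝ => ((Real.log ((1 - x) / x) : ℝ) : ℂ)) x :=
      Complex.continuous_ofReal.continuousAt.comp h3
    unfold powerSymbol
    fun_prop

lemma powerSymbol_inv_one_add (t : ℝ) {l : ℝ} (hl : 0 < l) : powerSymbol t (1 + l)⁻¹ =
    (((1 + l)⁻¹ * (1 - (1 + l)⁻¹) : ℝ) : ℂ) * Complex.exp (Complex.I * t * Real.log l) := by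
  have : (1 - (1 + l)⁻¹) / (1 + l)⁻¹ = l := by
    field_simp
    ring
  rw [powerSymbol, this]

lemma IsEigen.cfc_vec (hd : IsEigenFamily f e l) {a : A} {m : ℝ} (h : IsEigen f a m) (t : ℝ) :
    cfc (fun z : ℂ => powerSymbol t z.re) (resolvent f) (vec f a) =
      powerSymbol t (1 + m)⁻¹ • vec f a := by
  have hc : Continuous fun z : ℂ => powerSymbol t z.re :=
    (continuous_powerSymbol t).comp Complex.continuous_re
  rw [ContinuousLinearMap.cfc_apply_eigenvector (isPositive_resolvent hd).isSelfAdjoint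
    (h.resolvent_vec hd) hc.continuousOn, Complex.ofReal_re]

lemma IsEigen.resolvent_mul_vec (hd : IsEigenFamily f e l) {a : A} {m : ℝ} (h : IsEigen f a m) :
    (resolvent f * (1 - resolvent f)) (vec f a) =
      (((1 + m)⁻¹ * (1 - (1 + m)⁻¹) : ℝ) : ℂ) • vec f a := by
  rw [mul_apply_eq_comp, sub_apply, one_apply_eq_self,
    map_sub, h.resolvent_vec hd, map_smul, h.resolvent_vec hd, smul_smul, ← sub_smul]
  push_cast
  ring_nf

/-- An operator which acts on the eigenvectors of the modular operator like `Δ^{it}` is `Δ^{it}`. -/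
lemma modularUnitary_eq (hd : IsEigenFamily f e l) (t : ℝ) (W : f.GNS →L[ℂ] f.GNS)
    (hW : ∀ i, W (vec f (e i)) = Complex.exp (Complex.I * t * Real.log (l i)) • vec f (e i)) :
    modularUnitary f t = W := by
  -- `W` shows that the equation defining `modularUnitary` is solvable.
  have hspec := Classical.epsilon_spec (p := fun V : f.GNS →L[ℂ] f.GNS =>
    V * (resolvent f * (1 - resolvent f)) = cfc (fun z : ℂ => powerSymbol t z.re) (resolvent f))
    ⟨W, hd.clm_ext fun i => by
      rw [mul_apply_eq_comp, (hd.1 i).resolvent_mul_vec hd, map_smul, hW i, (hd.1 i).cfc_vec hd,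
        powerSymbol_inv_one_add t (hd.1 i).1, smul_smul]⟩
  refine hd.clm_ext fun i => ?_
  have h := hd.1 i
  have h1 := congrArg (fun V : f.GNS →L[ℂ] f.GNS => V (vec f (e i))) hspec
  beta_reduce at h1
  rw [mul_apply_eq_comp, h.resolvent_mul_vec hd, map_smul, h.cfc_vec hd,
    powerSymbol_inv_one_add t h.1, ← smul_smul] at h1
  rw [hW i]
  have hl := h.1
  -- `T (1 - T)` acts on this eigenvector by `l / (1 + l)² ≠ 0`, which cancels: the equation
  -- determines `V` there.
  refine smul_right_injective _ ?_ h1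
  rw [Complex.ofReal_ne_zero]
  have : (1 + l i)⁻¹ * (1 - (1 + l i)⁻¹) = l i / (1 + l i) ^ 2 := by
    field_simp
    ring
  rw [this]
  positivity

variable (f)

/-- The operator on the GNS space implementing a ⋆-endomorphism which leaves `f` invariant. -/
def implement (φ : A →⋆ₐ[ℂ] A) (hφ : ∀ a, f (φ a) = f a) : f.GNS →L[ℂ] f.GNS :=
  (LinearMap.mkContinuous
    (f.toPreGNS.toLinearMap ∘ₗ φ.toAlgHom.toLinearMap ∘ₗ f.ofPreGNS.toLinearMap) 1 fun a => by
      rw [one_mul, PositiveLinearMap.preGNS_norm_def, PositiveLinearMap.preGNS_norm_def]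
      change √(f (star (φ (f.ofPreGNS a)) * φ (f.ofPreGNS a))).re ≤ _
      rw [← map_star, ← map_mul, hφ]).completion

lemma implement_vec (φ : A →⋆ₐ[ℂ] A) (hφ : ∀ a, f (φ a) = f a) (a : A) :
    implement f φ hφ (vec f a) = vec f (φ a) :=
  (ContinuousLinearMap.completion_apply_coe _ _).trans rfl

lemma clm_ext_vec {V W : f.GNS →L[ℂ] f.GNS} (h : ∀ a, V (vec f a) = W (vec f a)) : V = W :=
  ContinuousLinearMap.coeFn_injective <|
    (denseRange_vec f).equalizer V.continuous W.continuous (funext h)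

end Modular

namespace SingleVertexKGraph

variable {k : ℕ} {Λ : Type*} [Monoid Λ] (X : SingleVertexKGraph k Λ)

/-! ### The modular automorphism group -/

/-- `log ∏ m_i ^ n_i`. -/
def logIndex (n : Fin k → ℤ) : ℝ := ∑ i, n i * Real.log (X.numEdges i)

lemma numEdges_pos (i : Fin k) : 0 < (X.numEdges i : ℝ) := by
  exact_mod_cast Nat.pos_of_ne_zero (X.numEdges_ne_zero i)

lemma mem_intrinsicGroup_iff (n : Fin k → ℤ) :
    n ∈ X.intrinsicGroup ↔ ∏ i, (X.numEdges i : ℚ) ^ n i = 1 := Iff.rfl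

lemma mem_intrinsicGroup_iff_logIndex (n : Fin k → ℤ) :
    n ∈ X.intrinsicGroup ↔ X.logIndex n = 0 := by
  have h0 : ∀ i, 0 < (X.numEdges i : ℝ) ^ n i := fun i => zpow_pos (X.numEdges_pos i) _
  have h : Real.log (∏ i, (X.numEdges i : ℝ) ^ n i) = X.logIndex n := by
    rw [Real.log_prod fun i _ => (h0 i).ne', logIndex]
    simp only [Real.log_zpow]
  rw [mem_intrinsicGroup_iff, ← h]
  have h1 : (∏ i, (X.numEdges i : ℚ) ^ n i = 1) ↔ (∏ i, (X.numEdges i : ℝ) ^ n i = 1) := by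
    rw [← Rat.cast_inj (α := ℝ)]
    push_cast
    rfl
  rw [h1]
  constructor
  · intro h2
    rw [h2, Real.log_one]
  · exact Real.eq_one_of_pos_of_log_eq_zero (Finset.prod_pos fun i _ => h0 i)

lemma log_weight (w : Λ) : Real.log (X.weight w) = X.logIndex (X.zdeg w) := by
  rw [weight, X.card_words, Nat.cast_prod, Real.log_prod fun i _ => by
    exact_mod_cast pow_ne_zero _ (X.numEdges_ne_zero i)]
  simp [logIndex, zdeg]

lemma logIndex_sub (n m : Fin k → ℤ) : X.logIndex (n - m) = X.logIndex n - X.logIndex m := by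
  simp [logIndex, sub_mul]

/-- The one-parameter subgroup of the torus through which the modular group of `ω` acts. -/
def flow (t : ℝ) : UnitAddTorus (Fin k) :=
  fun i => ((-t * Real.log (X.numEdges i) / (2 * Real.pi) : ℝ) : UnitAddCircle)

lemma flow_add_neg (t : ℝ) : X.flow t + X.flow (-t) = 0 := by
  funext i
  simp only [flow, Pi.add_apply, ← AddCircle.coe_add, Pi.zero_apply]
  rw [← add_div, ← add_mul, ← neg_add, add_neg_cancel]
  simp

/-- The value is `∏ m_i ^ (-i t n_i)`; the sign in `flow` makes it the eigenvalue of `Δ^{it}` on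
vectors of degree `n`. -/
lemma mFourier_flow (n : Fin k → ℤ) (t : ℝ) :
    mFourier n (X.flow t) = Complex.exp (Complex.I * t * (-X.logIndex n : ℝ)) := by
  simp only [mFourier, ContinuousMap.coe_mk, flow, fourier_coe_apply, logIndex]
  rw [← Complex.exp_sum]
  congr 1
  push_cast
  rw [← Finset.sum_neg_distrib, Finset.mul_sum]
  refine Finset.sum_congr rfl fun i _ => ?_
  have : (Real.pi : ℂ) ≠ 0 := by exact_mod_cast Real.pi_ne_zero
  field_simp

lemma mem_intrinsicGroup_iff_flow (n : Fin k → ℤ) :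
    n ∈ X.intrinsicGroup ↔ ∀ t, mFourier n (X.flow t) = 1 := by
  rw [mem_intrinsicGroup_iff_logIndex]
  constructor
  · intro h t
    rw [mFourier_flow, h]
    simp
  · intro h
    by_contra h0
    -- At this time the character takes the value `e^{-iπ} = -1`.
    have h1 := h (Real.pi / X.logIndex n)
    rw [mFourier_flow] at h1
    have h2 : Complex.I * ((Real.pi / X.logIndex n : ℝ) : ℂ) * ((-X.logIndex n : ℝ) : ℂ) =
        -(Real.pi * Complex.I) := by
      have : (X.logIndex n : ℂ) ≠ 0 := by exact_mod_cast h0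
      push_cast
      field_simp
    rw [h2, Complex.exp_neg, Complex.exp_pi_mul_I] at h1
    norm_num at h1

/-- The operator on the GNS space of `ω` implementing a gauge automorphism. -/
def gaugeUnitary (u : UnitAddTorus (Fin k)) : X.omega.GNS →L[ℂ] X.omega.GNS :=
  Modular.implement X.omega (X.gauge u) (X.omega_gauge u)

lemma gaugeUnitary_vec (u : UnitAddTorus (Fin k)) (a : X.GraphAlg) :
    X.gaugeUnitary u (Modular.vec X.omega a) = Modular.vec X.omega (X.gauge u a) :=
  Modular.implement_vec _ _ _ a

lemma isEigenFamily_mono [Nontrivial X.GraphAlg] :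
    Modular.IsEigenFamily X.omega (fun x : Λ × Λ => X.mono x.1 x.2)
      (fun x => X.weight x.2 / X.weight x.1) := by
  refine ⟨fun x => ⟨div_pos (X.weight_pos _) (X.weight_pos _), fun b => ?_⟩,
    X.closure_span_monomials⟩
  have h1 : (X.weight x.1 : ℂ) ≠ 0 := by exact_mod_cast (X.weight_pos _).ne'
  have h2 : (X.weight x.2 : ℂ) ≠ 0 := by exact_mod_cast (X.weight_pos _).ne'
  rw [star_mono, X.omega_mono_mul]
  push_cast
  field_simp

lemma modularUnitary_omega [Nontrivial X.GraphAlg] (t : ℝ) :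
    Modular.modularUnitary X.omega t = X.gaugeUnitary (X.flow t) := by
  refine Modular.modularUnitary_eq X.isEigenFamily_mono t _ fun x => ?_
  rw [gaugeUnitary_vec, gauge_mono, Modular.vec_smul, mFourier_flow,
    Real.log_div (X.weight_pos _).ne' (X.weight_pos _).ne', log_weight, log_weight, logIndex_sub,
    neg_sub]

/-- On `π(b)Ω` this is `γ_u(a γ_{-u}(b)) = γ_u(a) b` with `u = flow t`. -/
lemma modularAut_omega [Nontrivial X.GraphAlg] (t : ℝ) (a : X.GraphAlg) :
    Modular.modularAut X.omega t (X.omega.gnsStarAlgHom a) =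
      X.omega.gnsStarAlgHom (X.gauge (X.flow t) a) := by
  refine Modular.clm_ext_vec _ fun b => ?_
  rw [Modular.modularAut, modularUnitary_omega, modularUnitary_omega, mul_apply_eq_comp,
    mul_apply_eq_comp, gaugeUnitary_vec, Modular.gns_vec, gaugeUnitary_vec, Modular.gns_vec, map_mul,
    gauge_gauge, flow_add_neg, gauge_zero]

/-! ### Faithfulness of the GNS representation. -/

lemma nontrivial_gns [Nontrivial X.GraphAlg] : Nontrivial X.omega.GNS := by
  refine ⟨⟨Modular.vec X.omega 1, 0, fun h => ?_⟩⟩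
  have h1 := Modular.inner_vec X.omega 1 1
  rw [h, inner_zero_left, star_one, one_mul, X.omega_one] at h1
  exact zero_ne_one h1

/-- The GNS representation of `ω` is faithful. -/
lemma gns_injective [Nontrivial X.GraphAlg] : Function.Injective X.omega.gnsStarAlgHom := by
  have := X.nontrivial_gns
  rw [injective_iff_map_eq_zero]
  intro b hb
  -- The gauge action is implemented on the GNS space, so the kernel is gauge invariant and hence,
  -- by integration, stable under every `Φ_n`.
  have hg : ∀ u, X.omega.gnsStarAlgHom (X.gauge u b) = 0 := fun u => by
    refine Modular.clm_ext_vec _ fun c => ?_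
    have h1 : X.gauge u b * c = X.gauge u (b * X.gauge (-u) c) := by
      rw [map_mul, gauge_gauge, add_neg_cancel, gauge_zero]
    rw [Modular.gns_vec, h1, ← gaugeUnitary_vec, ← Modular.gns_vec, hb]
    simp
  let L : X.GraphAlg →L[ℂ] (X.omega.GNS →L[ℂ] X.omega.GNS) :=
    ⟨X.omega.gnsStarAlgHom.toAlgHom.toLinearMap, X.omega.gnsStarAlgHom.continuous_of_cstar⟩
  have hPhi : ∀ n, X.omega.gnsStarAlgHom (X.Phi n b) = 0 := fun n => by
    have h := L.integral_comp_comm (X.integrable_Phi n b)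
    have hL : ∀ u, L (X.gauge u b) = 0 := hg
    simp only [map_smul, hL, smul_zero, integral_zero] at h
    exact h.symm
  refine X.eq_zero_of_Phi_eq_zero fun n => ?_
  have hhom : X.IsHomog (X.Phi n b) n := fun t => X.gauge_Phi t n b
  have hcore : star (X.Phi n b) * X.Phi n b ∈ X.core := by
    have := hhom.star.mul hhom
    rw [neg_add_cancel] at this
    exact X.mem_core_iff.mpr this
  -- `Φ_n(b)⋆ Φ_n(b)` is in the core, where the representation is isometric, and it is mapped to
  -- `0`.
  have hnorm := X.norm_map_of_mem_core X.omega.gnsStarAlgHom hcore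
  rw [map_mul, hPhi, mul_zero, norm_zero] at hnorm
  exact CStarRing.star_mul_self_eq_zero_iff _ |>.mp (norm_eq_zero.mp hnorm.symm)

lemma mem_fixedPoints_iff [Nontrivial X.GraphAlg] (a : X.GraphAlg) :
    a ∈ Modular.fixedPoints X.omega ↔ ∀ t, X.gauge (X.flow t) a = a := by
  refine forall_congr' fun t => ?_
  rw [modularAut_omega]
  exact X.gns_injective.eq_iff

/-! ### The fixed point algebra as a generated C⋆-algebra. -/

lemma cstar_le_of_subset {M : Set X.GraphAlg} {N : StarSubalgebra ℂ X.GraphAlg}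
    (hN : IsClosed (N : Set X.GraphAlg)) (h : M ⊆ N) : X.cstar M ≤ N :=
  StarSubalgebra.topologicalClosure_minimal (StarAlgebra.adjoin_le h) hN

lemma subset_cstar (M : Set X.GraphAlg) : M ⊆ X.cstar M := fun _ ha =>
  StarSubalgebra.le_topologicalClosure _ (StarAlgebra.subset_adjoin ℂ _ ha)

lemma isClosed_cstar (M : Set X.GraphAlg) : IsClosed (X.cstar M : Set X.GraphAlg) :=
  StarSubalgebra.isClosed_topologicalClosure _

/-- The fixed points of the gauge automorphisms along the flow. -/
def flowFixed : StarSubalgebra ℂ X.GraphAlg where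
  carrier := {a | ∀ t, X.gauge (X.flow t) a = a}
  mul_mem' h h' t := by rw [map_mul, h t, h' t]
  add_mem' h h' t := by rw [map_add, h t, h' t]
  algebraMap_mem' c t := AlgHomClass.commutes (X.gauge (X.flow t)) c
  star_mem' h t := by rw [map_star, h t]

lemma isClosed_flowFixed : IsClosed (X.flowFixed : Set X.GraphAlg) := by
  change IsClosed {a : X.GraphAlg | ∀ t, X.gauge (X.flow t) a = a}
  simp only [Set.ofPred_forall]
  exact isClosed_iInter fun t => isClosed_eq (X.gauge _).continuous_of_cstar continuous_id

/-- For a fixed `a`, `Φ_n(a) = Φ_n(γ_{flow t} a)` is `Φ_n(a)` times the character value. If `n ∉ G`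
that value differs from `1` at some `t`, so only components with degree in `G` survive. -/
lemma flowFixed_eq : X.flowFixed = X.cstar {a | ∃ n ∈ X.intrinsicGroup, X.HasDegree a n} := by
  refine le_antisymm (fun a ha => ?_) (X.cstar_le_of_subset X.isClosed_flowFixed ?_)
  · have hle : Submodule.span ℂ (Set.range fun n => X.Phi n a) ≤
        (X.cstar {a | ∃ n ∈ X.intrinsicGroup, X.HasDegree a n}).toSubalgebra.toSubmodule := by
      rw [Submodule.span_le]
      rintro _ ⟨n, rfl⟩
      by_cases hn : n ∈ X.intrinsicGroup
      · exact X.subset_cstar _ ⟨n, hn, a, rfl⟩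
      · rw [mem_intrinsicGroup_iff_flow] at hn
        push Not at hn
        obtain ⟨t, ht⟩ := hn
        have h1 := X.Phi_gauge (X.flow t) n a
        rw [ha t] at h1
        have h2 : (mFourier n (X.flow t) - 1) • X.Phi n a = 0 := by
          rw [sub_smul, ← h1, one_smul, sub_self]
        have h3 : X.Phi n a = 0 := (smul_eq_zero.mp h2).resolve_left (sub_ne_zero.mpr ht)
        simp only [h3]
        exact zero_mem _
    exact Submodule.topologicalClosure_minimal _ hle (X.isClosed_cstar _)
      (X.mem_closure_span_Phi a)
  · rintro a ⟨n, hn, ha⟩ t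
    rw [hasDegree_iff.mp ha, (X.mem_intrinsicGroup_iff_flow n).mp hn t, one_smul]

lemma fixedPoints_omega : Modular.fixedPoints X.omega =
    (X.cstar {a | ∃ n ∈ X.intrinsicGroup, X.HasDegree a n} : Set X.GraphAlg) := by
  -- In the zero algebra `ω` is not a state, and the claim is trivial.
  rcases subsingleton_or_nontrivial X.GraphAlg with h | h
  · ext a
    rw [Subsingleton.elim a 0]
    refine ⟨fun _ => zero_mem _, fun _ t => ?_⟩
    simp [Modular.modularAut]
  · rw [← flowFixed_eq]
    ext a
    exact X.mem_fixedPoints_iff a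

/-! ### The unitaries `U_p` -/

/-- Since `g = g₊ - g₋`, the relation `∏ m_i ^ g_i = 1` equates `∏ m_i ^ (g₊)_i` and `∏ m_i ^
(g₋)_i`, the two numbers of words. -/
lemma card_words_posPart {g : Fin k → ℤ} (hg : g ∈ X.intrinsicGroup) :
    Fintype.card (X.Words (posPart g)) = Fintype.card (X.Words (negPart g)) := by
  have h : ∀ i, (X.numEdges i : ℚ) ≠ 0 := fun i => by exact_mod_cast X.numEdges_ne_zero i
  have hn : ∏ i, (X.numEdges i : ℚ) ^ (-g i).toNat ≠ 0 :=
    Finset.prod_ne_zero_iff.mpr fun i _ => pow_ne_zero _ (h i)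
  have h1 : ∏ i, (X.numEdges i : ℚ) ^ (g i).toNat = ∏ i, (X.numEdges i : ℚ) ^ (-g i).toNat := by
    rw [← div_eq_one_iff_eq hn, ← Finset.prod_div_distrib, ← (X.mem_intrinsicGroup_iff g).mp hg]
    refine Finset.prod_congr rfl fun i _ => ?_
    rw [← zpow_natCast, ← zpow_natCast, ← zpow_sub₀ (h i), Int.toNat_sub_toNat_neg]
  rw [X.card_words, X.card_words]
  exact_mod_cast h1

lemma star_exchange {p q : Fin k → ℕ} (j : X.Words p ≃ X.Words q) :
    star (X.exchange j) = X.exchange j.symm := by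
  simp only [exchange, star_sum, star_mul, star_star]
  rw [← j.sum_comp]
  simp

/-- Distinct words of degree `q` have orthogonal ranges, so in the double sum only the terms `s_u
s_u⋆` remain. -/
lemma exchange_mul_exchange_symm {p q : Fin k → ℕ} (j : X.Words p ≃ X.Words q) :
    X.exchange j * X.exchange j.symm = 1 := by
  classical
  rw [← X.sum_s_mul_star p, exchange, exchange, Finset.sum_mul_sum]
  refine Finset.sum_congr rfl fun u _ => ?_
  rw [Finset.sum_eq_single (j u)]
  · rw [mul_assoc, ← mul_assoc (star _), X.star_s_mul_self, one_mul, j.symm_apply_apply]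
  · intro v _ hv
    rw [mul_assoc, ← mul_assoc (star _), X.star_s_mul_of_ne q _ _ hv.symm, zero_mul, mul_zero]
  · simp

lemma exchange_mem_unitary {p q : Fin k → ℕ} (j : X.Words p ≃ X.Words q) :
    X.exchange j ∈ unitary X.GraphAlg := by
  rw [Unitary.mem_iff, star_exchange]
  exact ⟨by simpa using X.exchange_mul_exchange_symm j.symm, X.exchange_mul_exchange_symm j⟩

lemma isHomog_exchange {g : Fin k → ℤ} (j : X.Words (posPart g) ≃ X.Words (negPart g)) :
    X.IsHomog (X.exchange j) g := by
  intro t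
  rw [exchange, map_sum, Finset.smul_sum]
  refine Finset.sum_congr rfl fun u _ => ?_
  have h := X.gauge_mono t u.1 (j u).1
  have hd : X.zdeg u.1 - X.zdeg (j u).1 = g := by
    funext i
    have h1 : X.deg u.1 i = (g i).toNat := congrFun u.2 i
    have h2 : X.deg (j u).1 i = (-g i).toNat := congrFun (j u).2 i
    simp only [zdeg, Pi.sub_apply, h1, h2, Int.toNat_sub_toNat_neg]
  rwa [hd] at h

/-- The degrees of the unitary homogeneous elements of a ⋆-subalgebra form a group. -/
def unitaryDegrees (N : StarSubalgebra ℂ X.GraphAlg) : AddSubgroup (Fin k → ℤ) where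
  carrier := {n | ∃ U ∈ N, U ∈ unitary X.GraphAlg ∧ X.IsHomog U n}
  zero_mem' := ⟨1, one_mem _, one_mem _, X.mem_core_iff.mp (one_mem _)⟩
  add_mem' := by
    rintro n m ⟨U, hU, hU1, hU2⟩ ⟨V, hV, hV1, hV2⟩
    exact ⟨U * V, mul_mem hU hV, mul_mem hU1 hV1, hU2.mul hV2⟩
  neg_mem' := by
    rintro n ⟨U, hU, hU1, hU2⟩
    exact ⟨star U, star_mem hU, Unitary.star_mem hU1, hU2.star⟩

lemma cstar_intrinsic_eq {r : ℕ} (g : Module.Basis (Fin r) ℤ X.intrinsicGroup)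
    (j : ∀ p : Fin r, X.Words (posPart (g p : Fin k → ℤ)) ≃ X.Words (negPart (g p : Fin k → ℤ))) :
    X.cstar {a | ∃ n ∈ X.intrinsicGroup, X.HasDegree a n} =
      X.cstar ((X.core : Set X.GraphAlg) ∪ Set.range fun p => X.exchange (j p)) := by
  set N := X.cstar ((X.core : Set X.GraphAlg) ∪ Set.range fun p => X.exchange (j p)) with hN
  have hsub : (X.core : Set X.GraphAlg) ∪ (Set.range fun p => X.exchange (j p)) ⊆ N :=
    X.subset_cstar _
  refine le_antisymm (X.cstar_le_of_subset (X.isClosed_cstar _) ?_)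
    (X.cstar_le_of_subset (X.isClosed_cstar _) ?_)
  · rintro a ⟨n, hn, ha⟩
    -- The degrees of homogeneous unitaries of `N` form a group containing the basis `g_p`, hence
    -- all of `G`.
    have hspan : ∀ x : X.intrinsicGroup, (x : Fin k → ℤ) ∈ X.unitaryDegrees N := fun x => by
      rw [← g.sum_repr x, AddSubgroup.val_finsetSum]
      refine AddSubgroup.sum_mem _ fun p _ => ?_
      rw [AddSubgroup.coe_zsmul]
      have hp : (g p : Fin k → ℤ) ∈ X.unitaryDegrees N := ⟨X.exchange (j p),
        hsub (Or.inr ⟨p, rfl⟩), X.exchange_mem_unitary _, X.isHomog_exchange _⟩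
      exact AddSubgroup.zsmul_mem _ hp _
    obtain ⟨U, hU, hU1, hU2⟩ := hspan ⟨n, hn⟩
    have hcore : a * star U ∈ X.core := by
      have := (hasDegree_iff.mp ha).mul hU2.star
      rw [add_neg_cancel] at this
      exact X.mem_core_iff.mpr this
    have h1 : a = a * star U * U := by
      rw [mul_assoc, Unitary.star_mul_self_of_mem hU1, mul_one]
    rw [h1]
    exact mul_mem (hsub (Or.inl hcore)) hU
  · rintro a (ha | ⟨p, rfl⟩)
    · exact X.subset_cstar _ ⟨0, zero_mem _, hasDegree_iff.mpr (X.mem_core_iff.mp ha)⟩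
    · exact X.subset_cstar _ ⟨_, (g p).2, hasDegree_iff.mpr (X.isHomog_exchange (j p))⟩

end SingleVertexKGraph

end

theorem mainTheorem7 {k : ℕ} {Λ : Type*} [Monoid Λ] (X : SingleVertexKGraph k Λ)
    {r : ℕ} (g : Module.Basis (Fin r) ℤ X.intrinsicGroup) :
    (∀ p : Fin r, Nonempty (X.Words (SingleVertexKGraph.posPart (g p : Fin k → ℤ)) ≃
      X.Words (SingleVertexKGraph.negPart (g p : Fin k → ℤ)))) ∧
    ∀ j : ∀ p : Fin r, X.Words (SingleVertexKGraph.posPart (g p : Fin k → ℤ)) ≃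
        X.Words (SingleVertexKGraph.negPart (g p : Fin k → ℤ)),
      (∀ p, X.exchange (j p) ∈ unitary X.GraphAlg) ∧
      Modular.fixedPoints X.omega =
        (X.cstar {a | ∃ n ∈ X.intrinsicGroup, X.HasDegree a n} : Set X.GraphAlg) ∧
      X.cstar {a | ∃ n ∈ X.intrinsicGroup, X.HasDegree a n} =
        X.cstar ((X.core : Set X.GraphAlg) ∪ Set.range fun p => X.exchange (j p)) :=
  ⟨fun p => Fintype.card_eq.mp (X.card_words_posPart (g p).2), fun j =>
    ⟨fun p => X.exchange_mem_unitary (j p), X.fixedPoints_omega, X.cstar_intrinsic_eq g j⟩⟩
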